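/- **Model.** Let $f:[0,1]\to\mathbb R$ be differentiable, strictly convex and nondecreasing with $f(0)=0$; put $\underline c=f'(0)$, $\overline c=f'(1)$ (one-sided derivatives), let $f'^{-1}:[\underline c,\overline c]\to[0,1]$ be the inverse of $f'$, and let $\overline p>\underline c$. Let $\mathcal K$ be a finite set of resource types, each with capacity $1$ and supply cost function $f$. A bundle is a vector $b=(r^b_k)_{k\in\mathcal K}$ of nonnegative demands. Bundles are small compared with the capacity: we are given a sequence of finite sets $\mathcal B_m$ of bundles with $\max_{b\in\mathcal B_m,k}r_k^b\to0$ as $m\to\infty$, where each $\mathcal B_m$ contains the empty bundle $\emptyset=0$ and at least one nonempty bundle consisting of a single type of resource. These data form the setup $\mathcal S$. An arrival instance $\mathcal A$ for $\mathcal B_m$ is a finite sequence of customers $n=1,\dots,N$ with arrival times $t_1\le\dots\le t_N$ and valuation functions $v_n:\mathcal B_m\to\mathbb R$ with $v_n(\emptyset)=0$ and $v_n(b)/r^b_k\le\overline p$ whenever $r^b_k\ne0$. An allocation $(b_n)_{n\le N}$, $b_n\in\mathcal B_m$, is feasible if $y_k=\sum_n r_k^{b_n}\le1$ for all $k$; its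 social welfare is $\sum_n v_n(b_n)-\sum_k f(y_k)$. $W_{\mathsf{opt}}(\mathcal A)$ denotes the maximal welfare of a feasible allocation. An online algorithm is a deterministic rule that chooses $b_n$ irrevocably as a function of the customers $1,\dots,n$ only and always produces feasible allocations (it may depend on $\mathcal S$ and $m$); $W_{\mathsf{online}}(\mathcal A)$ denotes its welfare. For $\alpha\ge1$, an online algorithm is $\alpha$-competitive (in the small-bundle regime) if for every $\varepsilon>0$, for all sufficiently large $m$, $$W_{\mathsf{online}}(\mathcal A)\ \ge\ \tfrac1\alpha W_{\mathsf{opt}}(\mathcal A)-\varepsilon\qquad\text{for all arrival instances }\mathcal A\text{ for }\mathcal B_m .$$ **Boundary value problems.** For $\alpha\ge1$ consider real functions $\phi$, continuous up to the boundary of the intervals below, such that the right-hand sides are defined. * $\mathsf L(\alpha)$, with $v=f'^{-1}(\overline p)$: $\ \phi'(y)=\alpha\,\frac{\phi(y)-f'(y)}{f'^{-1}(\phi(y))}$ for $y\in(0,v)$, $\ \phi(0)=\underline c$, $\ \phi(v)\ge\overline p$. * $\mathsf H_1(u,\alpha)$: $\ \phi'(y)=\alpha\,\frac{\phi(y)-f'(y)}{f'^{-1}(\phi(y))}$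 for $y\in(0,u)$, $\ \phi(0)=\underline c$, $\ \phi(u)=\overline c$. * $\mathsf H_2(u,\alpha)$: $\ \phi'(y)=\alpha(\phi(y)-f'(y))$ for $y\in(u,1)$, $\ \phi(u)=\overline c$, $\ \phi(1)\ge\overline p$. Let $\alpha_*(\mathcal S)\in[1,\infty]$ be the infimum of all $\alpha\ge1$ for which there is a strictly increasing function $\phi$ that solves $\mathsf L(\alpha)$, if $\overline p\le\overline c$, respectively solves both $\mathsf H_1(u,\alpha)$ and $\mathsf H_2(u,\alpha)$ for some $u\in(0,1)$, if $\overline p>\overline c$ (with $\inf\emptyset=\infty$). **Proposition.** $\alpha_*(\mathcal S)$ is the optimal competitive ratio achievable by online algorithms: if $\alpha_*(\mathcal S)<\infty$, then it is the smallest $\alpha$ for which an $\alpha$-competitive online algorithm exists; if $\alpha_*(\mathcal S)=\infty$, then no online algorithm is $\alpha$-competitive for any finite $\alpha$. Consequently, for every $\varepsilon>0$ there is no $(\alpha_*(\mathcal S)-\varepsilon)$-competitive online algorithm (nor an $\alpha$-competitive one for any finite $\alpha\le\alpha_*(\mathcal S)-\varepsilon$). -/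

import Mathlib

open Set Filter

/-!
# Online combinatorial auctions with supply costs and capacity limits
-/

namespace OnlineCA

noncomputable section

/-- The marginal cost `f'` on the capacity range `[0, 1]` (one-sided at the two end points). -/
def marginal (f : ℝ → ℝ) (y : ℝ) : ℝ := derivWithin f (Icc 0 1) y

/-- The inverse `f'⁻¹` of the marginal cost, meaningful on the range `f' '' [0, 1]`. -/
def marginalInv (f : ℝ → ℝ) (p : ℝ) : ℝ := Function.invFunOn (marginal f) (Icc 0 1) p

/-- The boundary value problem `L(α)`, with `v = f'⁻¹(p̄)`:
`φ' = α (φ - f') / f'⁻¹(φ)` on `(0, v)`, `φ(0) = f'(0)`, `φ(v) ≥ p̄`. A solution is continuous up to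
the boundary, and takes its values on `(0, v)` in the domain of `f'⁻¹`. -/
def SolvesL (f : ℝ → ℝ) (pbar α : ℝ) (φ : ℝ → ℝ) : Prop :=
  ContinuousOn φ (Icc 0 (marginalInv f pbar)) ∧
  (∀ y ∈ Ioo 0 (marginalInv f pbar), φ y ∈ marginal f '' Icc 0 1 ∧
    HasDerivAt φ (α * ((φ y - marginal f y) / marginalInv f (φ y))) y) ∧
  φ 0 = marginal f 0 ∧ pbar ≤ φ (marginalInv f pbar)

/-- The boundary value problem `H₁(u, α)`:
`φ' = α (φ - f') / f'⁻¹(φ)` on `(0, u)`, `φ(0) = f'(0)`, `φ(u) = f'(1)`. -/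
def SolvesH1 (f : ℝ → ℝ) (u α : ℝ) (φ : ℝ → ℝ) : Prop :=
  ContinuousOn φ (Icc 0 u) ∧
  (∀ y ∈ Ioo 0 u, φ y ∈ marginal f '' Icc 0 1 ∧
    HasDerivAt φ (α * ((φ y - marginal f y) / marginalInv f (φ y))) y) ∧
  φ 0 = marginal f 0 ∧ φ u = marginal f 1

/-- The boundary value problem `H₂(u, α)`:
`φ' = α (φ - f')` on `(u, 1)`, `φ(u) = f'(1)`, `φ(1) ≥ p̄`. -/
def SolvesH2 (f : ℝ → ℝ) (pbar u α : ℝ) (φ : ℝ → ℝ) : Prop :=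
  ContinuousOn φ (Icc u 1) ∧
  (∀ y ∈ Ioo u 1, HasDerivAt φ (α * (φ y - marginal f y)) y) ∧
  φ u = marginal f 1 ∧ pbar ≤ φ 1

/-- There is a strictly increasing solution of the boundary value problem(s) with parameter `α`:
of `L(α)` if `p̄ ≤ f'(1)`, and of `H₁(u, α)` and `H₂(u, α)` simultaneously, for some dividing
threshold `u ∈ (0, 1)`, if `p̄ > f'(1)`. -/
def BVPSolvable (f : ℝ → ℝ) (pbar α : ℝ) : Prop :=
  ∃ φ : ℝ → ℝ,
    (pbar ≤ marginal f 1 ∧ StrictMonoOn φ (Icc 0 (marginalInv f pbar)) ∧ SolvesL f pbar α φ) ∨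
    (marginal f 1 < pbar ∧ StrictMonoOn φ (Icc 0 1) ∧
      ∃ u ∈ Ioo (0 : ℝ) 1, SolvesH1 f u α φ ∧ SolvesH2 f pbar u α φ)

/-- A setup with resource types `K`, whose capacities are normalized to `1`. A bundle is the vector
of its demands. That bundles are small compared with the capacity is a limiting regime: there is a
sequence of finite bundle sets whose largest demand tends to `0`. -/
structure Setup (K : Type*) where
  /-- the supply cost function, the same for all resource types -/
  f : ℝ → ℝ
  f_diff : DifferentiableOn ℝ f (Icc 0 1)
  f_strictConvex : StrictConvexOn ℝ (Icc 0 1) f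
  f_mono : MonotoneOn f (Icc 0 1)
  f_zero : f 0 = 0
  /-- the upper bound on per-unit valuations -/
  pbar : ℝ
  lt_pbar : marginal f 0 < pbar
  /-- the bundle sets -/
  bundles : ℕ → Finset (K → ℝ)
  empty_mem : ∀ m, (0 : K → ℝ) ∈ bundles m
  nonneg : ∀ m, ∀ b ∈ bundles m, ∀ k, 0 ≤ b k
  small : ∀ δ : ℝ, 0 < δ → ∀ᶠ m in atTop, ∀ b ∈ bundles m, ∀ k, b k ≤ δ
  /-- some nonempty bundle consists of a single type of resource -/
  single : ∀ m, ∃ b ∈ bundles m, ∃ k, 0 < b k ∧ ∀ j, j ≠ k → b j = 0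

/-- A customer: an arrival time and a valuation function on the bundles. -/
structure Customer {K : Type*} (B : Finset (K → ℝ)) where
  time : ℝ
  val : ↥B → ℝ

/-- Arrival instances: finite sequences of customers in order of arrival, whose valuations vanish on
the empty bundle and have all per-unit valuations bounded by `p̄`. -/
def IsInstance {K : Type*} (pbar : ℝ) {B : Finset (K → ℝ)} (l : List (Customer B)) : Prop :=
  l.Pairwise (fun c d => c.time ≤ d.time) ∧
  ∀ c ∈ l, (∀ b : ↥B, b.1 = 0 → c.val b = 0) ∧
    ∀ (b : ↥B) (k : K), b.1 k ≠ 0 → c.val b / b.1 k ≤ pbar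

/-- Total utilization of resource `k` when customer `n` gets bundle `x n` (a rejected customer gets
the empty bundle). -/
def usage {K : Type*} {B : Finset (K → ℝ)} {N : ℕ} (x : Fin N → ↥B) (k : K) : ℝ :=
  ∑ n, (x n).1 k

/-- Social welfare of an allocation: total valuation minus total supply cost. -/
def welfare {K : Type*} [Fintype K] (f : ℝ → ℝ) {B : Finset (K → ℝ)} (l : List (Customer B))
    (x : Fin l.length → ↥B) : ℝ :=
  ∑ n, (l.get n).val (x n) - ∑ k, f (usage x k)

/-- The optimal offline social welfare, over all allocations that respect the capacity limits. -/
def offlineOpt {K : Type*} [Fintype K] (f : ℝ → ℝ) {B : Finset (K → ℝ)}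
    (l : List (Customer B)) : ℝ :=
  sSup {w : ℝ | ∃ x : Fin l.length → ↥B, (∀ k, usage x k ≤ 1) ∧ w = welfare f l x}

/-- A (deterministic) online algorithm: the bundle given to a customer is an irrevocable function
of the sequence of customers seen so far, up to and including the present one, and the capacity
limits are respected on every arrival instance. -/
structure OnlineAlgorithm {K : Type*} (pbar : ℝ) (B : Finset (K → ℝ)) where
  decide : List (Customer B) → ↥B
  feasible : ∀ l : List (Customer B), IsInstance pbar l →
    ∀ k, usage (fun n : Fin l.length => decide (l.take (n + 1))) k ≤ 1

/-- The social welfare achieved by an online algorithm on an arrival instance. -/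
def OnlineAlgorithm.onlineWelfare {K : Type*} [Fintype K] {pbar : ℝ} {B : Finset (K → ℝ)}
    (A : OnlineAlgorithm pbar B) (f : ℝ → ℝ) (l : List (Customer B)) : ℝ :=
  welfare f l (fun n => A.decide (l.take (n + 1)))

/-- There is an `α`-competitive online algorithm (`α ≥ 1`) in the regime of small bundles:
`W_online ≥ W_opt / α` on all arrival instances, up to an error that is uniform over all arrival
instances and vanishes as the size of the bundles tends to `0`. -/
def Setup.Achievable {K : Type*} [Fintype K] (S : Setup K) (α : ℝ) : Prop :=
  1 ≤ α ∧ ∃ A : ∀ m : ℕ, OnlineAlgorithm S.pbar (S.bundles m),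
    ∀ ε : ℝ, 0 < ε → ∀ᶠ m in atTop, ∀ l : List (Customer (S.bundles m)), IsInstance S.pbar l →
      1 / α * offlineOpt S.f l - ε ≤ (A m).onlineWelfare S.f l

/-- The infimum `α_*(S)` of the `α ≥ 1` for which the boundary value problems have a strictly
increasing solution (`⊤` if there is no such `α`). -/
def Setup.alphaStar {K : Type*} (S : Setup K) : EReal :=
  sInf {a : EReal | ∃ α : ℝ, a = (α : EReal) ∧ 1 ≤ α ∧ BVPSolvable S.f S.pbar α}

end

end OnlineCA

/-! Extend the inverse marginal cost to all prices by 0 and 1 (`supply`). Then `L`, `H₁` and `H₂`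
become one equation φ' = α(φ - f')/supply(φ) on [0, T], with T = supply(p̄). Since `supply` is the
derivative of the convex conjugate `profit`, the equation says (profit ∘ φ)' = α(φ - f').
Equivalently, G = profit(φ)/α + f has derivative φ, and φ(0) = f'(0) says G(0) = 0.

Sufficiency: post the price φ(y) for a resource with utilization y and let each customer take a most
profitable bundle. The revenue from a resource is then about G(y), so α(G(y) - f(y)) = profit(φ(y))
pays for the conjugate term of the dual bound Σ uₙ + Σ profit(πₖ) on the offline welfare. The
discretization error is proportional to the bundle size (`IsPricing.offlineOpt_le_mul`).

Necessity: for every α > 0 the equation has a backward solution φ from (T, p̄), strictly increasing,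
above f' inside (0, T), with φ(0) ≥ f'(0) (`IsCost.exists_solution`). If φ(0) = f'(0), it solves the
boundary value problems. Otherwise G(0) > 0, and an adversary offers a single resource at prices
climbing slowly along φ, with enough demand at each price to fill the capacity. Competitiveness at
every stopping time forces the sales to run ahead of φ by a fixed margin of welfare. At the price p̄
this would require more than the maximal profit, which is absurd (`IsCost.not_staircase`).

Thus achievable ratios are solvable. Conversely, the infimum of the solvable ratios is achievable,
because the offline welfare is bounded and a slightly larger ratio only adds a small error. -/

namespace OnlineCA

open scoped Topology NNReal

/-! ### Convex duality for the supply cost -/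

/-- The standing assumptions on a supply cost function. -/
structure IsCost (f : ℝ → ℝ) : Prop where
  diff : DifferentiableOn ℝ f (Icc 0 1)
  strictConvex : StrictConvexOn ℝ (Icc 0 1) f
  mono : MonotoneOn f (Icc 0 1)
  zero : f 0 = 0

/-- The profit-maximizing supply at the price `p`: the inverse of the marginal cost, extended by
`0` below its range and by `1` above it. -/
noncomputable def supply (f : ℝ → ℝ) (p : ℝ) : ℝ :=
  if p ≤ marginal f 0 then 0 else if marginal f 1 ≤ p then 1 else marginalInv f p

/-- The maximal profit at the price `p`, i.e. the convex conjugate of the cost function. -/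
noncomputable def profit (f : ℝ → ℝ) (p : ℝ) : ℝ := p * supply f p - f (supply f p)

theorem supply_of_le {f : ℝ → ℝ} {p : ℝ} (hp : p ≤ marginal f 0) : supply f p = 0 := if_pos hp

namespace IsCost

variable {f : ℝ → ℝ} (hf : IsCost f)
include hf

theorem hasDerivWithinAt {y : ℝ} (hy : y ∈ Icc (0 : ℝ) 1) :
    HasDerivWithinAt f (marginal f y) (Icc 0 1) y :=
  (hf.diff y hy).hasDerivWithinAt

theorem hasDerivAt {y : ℝ} (hy : y ∈ Ioo (0 : ℝ) 1) : HasDerivAt f (marginal f y) y :=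
  (hf.hasDerivWithinAt (Ioo_subset_Icc_self hy)).hasDerivAt (Icc_mem_nhds hy.1 hy.2)

theorem marginal_strictMonoOn : StrictMonoOn (marginal f) (Icc 0 1) :=
  hf.strictConvex.strictMonoOn_derivWithin hf.diff

theorem image_marginal : marginal f '' Icc 0 1 = Icc (marginal f 0) (marginal f 1) := by
  apply Subset.antisymm
  · rintro _ ⟨y, hy, rfl⟩
    exact ⟨hf.marginal_strictMonoOn.monotoneOn (by simp) hy hy.1,
      hf.marginal_strictMonoOn.monotoneOn hy (by simp) hy.2⟩
  · exact (ordConnected_Icc.image_derivWithin hf.diff).out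
      (mem_image_of_mem _ (by simp)) (mem_image_of_mem _ (by simp))

/-- By Darboux the image of a derivative is an interval, and a strictly increasing function onto an
interval has no jumps. So continuity of `f'` comes for free. -/
theorem marginal_continuousOn : ContinuousOn (marginal f) (Icc 0 1) := by
  intro y hy
  have hm := hf.marginal_strictMonoOn
  refine tendsto_order.2 ⟨fun b hb => ?_, fun b hb => ?_⟩
  · rcases lt_or_ge b (marginal f 0) with h | h
    · filter_upwards [self_mem_nhdsWithin] with z hz
      exact h.trans_le (hm.monotoneOn (by simp) hz hz.1)
    · obtain ⟨w, hw, rfl⟩ : b ∈ marginal f '' Icc 0 1 := by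
        rw [hf.image_marginal]
        exact ⟨h, hb.le.trans (hm.monotoneOn hy (by simp) hy.2)⟩
      filter_upwards [self_mem_nhdsWithin,
        mem_nhdsWithin_of_mem_nhds (Ioi_mem_nhds ((hm.lt_iff_lt hw hy).1 hb))] with z hz hz'
      exact hm hw hz hz'
  · rcases lt_or_ge (marginal f 1) b with h | h
    · filter_upwards [self_mem_nhdsWithin] with z hz
      exact (hm.monotoneOn hz (by simp) hz.2).trans_lt h
    · obtain ⟨w, hw, rfl⟩ : b ∈ marginal f '' Icc 0 1 := by
        rw [hf.image_marginal]
        exact ⟨(hm.monotoneOn (by simp) hy hy.1).trans hb.le, h⟩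
      filter_upwards [self_mem_nhdsWithin,
        mem_nhdsWithin_of_mem_nhds (Iio_mem_nhds ((hm.lt_iff_lt hy hw).1 hb))] with z hz hz'
      exact hm hz hw hz'

theorem nonneg {y : ℝ} (hy : y ∈ Icc (0 : ℝ) 1) : 0 ≤ f y :=
  hf.zero ▸ hf.mono (by simp) hy hy.1

theorem marginal_zero_nonneg : 0 ≤ marginal f 0 :=
  hf.mono.derivWithin_nonneg

theorem marginal_zero_lt_one : marginal f 0 < marginal f 1 :=
  hf.marginal_strictMonoOn (by simp) (by simp) one_pos

theorem marginalInv_spec {p : ℝ} (hp : p ∈ Icc (marginal f 0) (marginal f 1)) :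
    marginalInv f p ∈ Icc (0 : ℝ) 1 ∧ marginal f (marginalInv f p) = p := by
  rw [← hf.image_marginal] at hp
  exact ⟨Function.invFunOn_mem hp, Function.invFunOn_eq hp⟩

theorem marginalInv_marginal {y : ℝ} (hy : y ∈ Icc (0 : ℝ) 1) :
    marginalInv f (marginal f y) = y := by
  have h := hf.marginalInv_spec (hf.image_marginal ▸ mem_image_of_mem (marginal f) hy)
  exact hf.marginal_strictMonoOn.injOn h.1 hy h.2

theorem supply_mem (p : ℝ) : supply f p ∈ Icc (0 : ℝ) 1 := by
  unfold supply
  split_ifs with h1 h2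
  · simp
  · simp
  · exact (hf.marginalInv_spec ⟨(not_le.1 h1).le, (not_le.1 h2).le⟩).1

theorem supply_eq_marginalInv {p : ℝ} (hp : p ∈ Icc (marginal f 0) (marginal f 1)) :
    supply f p = marginalInv f p := by
  unfold supply
  split_ifs with h1 h2
  · rw [le_antisymm h1 hp.1, hf.marginalInv_marginal (by simp)]
  · rw [le_antisymm hp.2 h2, hf.marginalInv_marginal (by simp)]
  · rfl

theorem supply_marginal {y : ℝ} (hy : y ∈ Icc (0 : ℝ) 1) : supply f (marginal f y) = y := by
  rw [hf.supply_eq_marginalInv (hf.image_marginal ▸ mem_image_of_mem _ hy),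
    hf.marginalInv_marginal hy]

theorem supply_of_ge {p : ℝ} (hp : marginal f 1 ≤ p) : supply f p = 1 := by
  rw [supply, if_neg (hf.marginal_zero_lt_one.trans_le hp).not_ge, if_pos hp]

theorem supply_le_of_le_marginal {p z : ℝ} (hz : z ∈ Icc (0 : ℝ) 1) (h : p ≤ marginal f z) :
    supply f p ≤ z := by
  rcases le_or_gt p (marginal f 0) with h0 | h0
  · rw [supply_of_le h0]; exact hz.1
  · have h1 := h.trans (hf.marginal_strictMonoOn.monotoneOn hz (by simp) hz.2)
    obtain ⟨hm, he⟩ := hf.marginalInv_spec ⟨h0.le, h1⟩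
    rw [hf.supply_eq_marginalInv ⟨h0.le, h1⟩]
    rw [← he] at h
    exact (hf.marginal_strictMonoOn.le_iff_le hm hz).1 h

theorem le_supply_of_marginal_le {p z : ℝ} (hz : z ∈ Icc (0 : ℝ) 1) (h : marginal f z ≤ p) :
    z ≤ supply f p := by
  rcases le_or_gt (marginal f 1) p with h1 | h1
  · rw [hf.supply_of_ge h1]; exact hz.2
  · have h0 := (hf.marginal_strictMonoOn.monotoneOn (by simp) hz hz.1).trans h
    obtain ⟨hm, he⟩ := hf.marginalInv_spec ⟨h0, h1.le⟩
    rw [hf.supply_eq_marginalInv ⟨h0, h1.le⟩]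
    rw [← he] at h
    exact (hf.marginal_strictMonoOn.le_iff_le hz hm).1 h

theorem supply_mono : Monotone (supply f) := by
  intro p p' h
  by_contra! hlt
  have hm := hf.supply_mem p
  have hm' := hf.supply_mem p'
  obtain ⟨z, h1, h2⟩ := exists_between hlt
  have hz : z ∈ Icc (0 : ℝ) 1 := ⟨hm'.1.trans h1.le, h2.le.trans hm.2⟩
  have ha : marginal f z < p := by
    by_contra! hc
    exact h2.not_ge (hf.supply_le_of_le_marginal hz hc)
  exact h1.not_ge (hf.le_supply_of_marginal_le hz (ha.le.trans h))

theorem supply_continuous : Continuous (supply f) := by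
  refine continuous_iff_continuousAt.2 fun p => ?_
  have hm := hf.supply_mem p
  refine tendsto_order.2 ⟨fun b hb => ?_, fun b hb => ?_⟩
  · rcases lt_or_ge b 0 with h | h
    · exact Eventually.of_forall fun z => h.trans_le (hf.supply_mem z).1
    · obtain ⟨z, h1, h2⟩ := exists_between hb
      have hz : z ∈ Icc (0 : ℝ) 1 := ⟨h.trans h1.le, h2.le.trans hm.2⟩
      have ha : marginal f z < p := by
        by_contra! hc
        exact h2.not_ge (hf.supply_le_of_le_marginal hz hc)
      filter_upwards [Ioi_mem_nhds ha] with x hx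
      exact h1.trans_le (hf.le_supply_of_marginal_le hz (le_of_lt hx))
  · rcases lt_or_ge 1 b with h | h
    · exact Eventually.of_forall fun z => (hf.supply_mem z).2.trans_lt h
    · obtain ⟨z, h1, h2⟩ := exists_between hb
      have hz : z ∈ Icc (0 : ℝ) 1 := ⟨hm.1.trans h1.le, h2.le.trans h⟩
      have ha : p < marginal f z := by
        by_contra! hc
        exact h1.not_ge (hf.le_supply_of_marginal_le hz hc)
      filter_upwards [Iio_mem_nhds ha] with x hx
      exact (hf.supply_le_of_le_marginal hz (le_of_lt hx)).trans_lt h2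

theorem supply_pos {p : ℝ} (hp : marginal f 0 < p) : 0 < supply f p := by
  by_contra! h
  have h0 : supply f p = 0 := le_antisymm h (hf.supply_mem p).1
  have : ∃ z ∈ Ioo (0 : ℝ) 1, marginal f z < p := by
    have hc : Tendsto (marginal f) (𝓝[Icc 0 1] 0) (𝓝 (marginal f 0)) :=
      hf.marginal_continuousOn 0 (by simp)
    have h1 : ∀ᶠ z in 𝓝[>] (0 : ℝ), marginal f z < p :=
      (hc.mono_left (nhdsWithin_le_of_mem (Icc_mem_nhdsGT one_pos))).eventually
        (Iio_mem_nhds hp)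
    obtain ⟨z, hz, hz'⟩ := (h1.and (Ioo_mem_nhdsGT one_pos)).exists
    exact ⟨z, hz', hz⟩
  obtain ⟨z, hz, hzp⟩ := this
  have := hf.le_supply_of_marginal_le (Ioo_subset_Icc_self hz) hzp.le
  linarith [hz.1]

/-- The tangent line inequality. -/
theorem tangent_le {y z : ℝ} (hy : y ∈ Icc (0 : ℝ) 1) (hz : z ∈ Icc (0 : ℝ) 1) :
    f y + marginal f y * (z - y) ≤ f z := by
  have hd := hf.hasDerivWithinAt hy
  rcases lt_trichotomy y z with h | rfl | h
  · have := hf.strictConvex.convexOn.le_slope_of_hasDerivWithinAt hy hz h hd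
    rw [slope_def_field, le_div_iff₀ (by linarith)] at this
    linarith
  · simp
  · have := hf.strictConvex.convexOn.slope_le_of_hasDerivWithinAt hz hy h hd
    rw [slope_def_field, div_le_iff₀ (by linarith)] at this
    linarith

/-- The first-order condition at the maximizer of `p * y - f y`. The product vanishes unless `p`
lies outside the range of `f'`, when the maximizer is an end point. -/
theorem marginal_supply_mul_le (p : ℝ) {y : ℝ} (hy : y ∈ Icc (0 : ℝ) 1) :
    (p - marginal f (supply f p)) * (y - supply f p) ≤ 0 := by
  rcases le_or_gt p (marginal f 0) with h0 | h0
  · rw [supply_of_le h0]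
    exact mul_nonpos_of_nonpos_of_nonneg (by linarith) (by linarith [hy.1])
  rcases le_or_gt (marginal f 1) p with h1 | h1
  · rw [hf.supply_of_ge h1]
    exact mul_nonpos_of_nonneg_of_nonpos (by linarith) (by linarith [hy.2])
  · rw [hf.supply_eq_marginalInv ⟨h0.le, h1.le⟩, (hf.marginalInv_spec ⟨h0.le, h1.le⟩).2]
    simp

/-- Young's inequality. -/
theorem mul_sub_le_profit (p : ℝ) {y : ℝ} (hy : y ∈ Icc (0 : ℝ) 1) :
    p * y - f y ≤ profit f p := by
  have h1 := hf.tangent_le (hf.supply_mem p) hy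
  have h2 := hf.marginal_supply_mul_le p hy
  unfold profit
  nlinarith

theorem mul_supply_le_profit_sub (p p' : ℝ) :
    (p' - p) * supply f p ≤ profit f p' - profit f p := by
  have := hf.mul_sub_le_profit p' (hf.supply_mem p)
  unfold profit at *
  nlinarith

/-- Envelope theorem: the subgradient inequalities at `p` and at `x` squeeze the remainder between 0
and (x - p)(supply x - supply p), which is o(x - p) by continuity of `supply`. Differentiability of
`f'` is not needed. -/
theorem profit_hasDerivAt (p : ℝ) : HasDerivAt (profit f) (supply f p) p := by
  rw [hasDerivAt_iff_isLittleO]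
  have h1 : (fun x => profit f x - profit f p - (x - p) • supply f p) =O[𝓝 p]
      fun x => (x - p) * (supply f x - supply f p) := by
    refine Asymptotics.IsBigO.of_bound 1 (Eventually.of_forall fun x => ?_)
    have h2 := hf.mul_supply_le_profit_sub p x
    have h3 := hf.mul_supply_le_profit_sub x p
    rw [smul_eq_mul, Real.norm_of_nonneg (by linarith), one_mul]
    refine le_trans ?_ (le_abs_self _)
    nlinarith
  refine h1.trans_isLittleO ?_
  have h4 : (fun x => supply f x - supply f p) =o[𝓝 p] fun _ => (1 : ℝ) := by
    rw [Asymptotics.isLittleO_one_iff]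
    have := (hf.supply_continuous.tendsto p).sub_const (supply f p)
    simpa using this
  simpa using (Asymptotics.isBigO_refl (fun x => x - p) (𝓝 p)).mul_isLittleO h4

theorem profit_continuous : Continuous (profit f) :=
  continuous_iff_continuousAt.2 fun p => (hf.profit_hasDerivAt p).continuousAt

theorem profit_marginal_zero : profit f (marginal f 0) = 0 := by
  simp [profit, supply_of_le le_rfl, hf.zero]

theorem profit_strictMonoOn : StrictMonoOn (profit f) (Ici (marginal f 0)) := by
  refine strictMonoOn_of_deriv_pos (convex_Ici _) hf.profit_continuous.continuousOn fun p hp => ?_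
  rw [interior_Ici] at hp
  rw [(hf.profit_hasDerivAt p).deriv]
  exact hf.supply_pos hp

theorem profit_mono : Monotone (profit f) :=
  monotone_of_deriv_nonneg (fun p => (hf.profit_hasDerivAt p).differentiableAt) fun p => by
    rw [(hf.profit_hasDerivAt p).deriv]; exact (hf.supply_mem p).1

theorem profit_nonneg {p : ℝ} (h : marginal f 0 ≤ p) : 0 ≤ profit f p :=
  hf.profit_marginal_zero ▸ hf.profit_mono h

end IsCost

/-! ### Price functions and the posted price algorithm -/

/-- A monotone price function `φ` on `[0, T]`, reaching the maximal valuation `pbar`, together with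
a revenue bound `G` that grows at most at the rate `φ`, such that the dual profit is at most `α`
times the profit made by selling at the prices `φ`. -/
structure IsPricing (f : ℝ → ℝ) (pbar α T : ℝ) (φ G : ℝ → ℝ) : Prop where
  one_le : 1 ≤ α
  threshold_mem : T ∈ Icc (0 : ℝ) 1
  mono : MonotoneOn φ (Icc 0 T)
  nonneg : 0 ≤ φ 0
  pbar_le : pbar ≤ φ T
  revenue_zero : G 0 = 0
  revenue_le : ∀ y ∈ Icc 0 T, ∀ z ∈ Icc 0 T, y ≤ z → G z - G y ≤ φ z * (z - y)
  profit_le : ∀ y ∈ Icc 0 T, profit f (φ y) ≤ α * (G y - f y)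

section PostedPrices

variable {K : Type*} [Fintype K] {B : Finset (K → ℝ)}

/-- A bundle is available at the utilization `y` if it uses no resource whose utilization exceeds
`s`. -/
def Available (s : ℝ) (y b : K → ℝ) : Prop := ∀ k, b k ≠ 0 → y k ≤ s

theorem exists_best_bundle (h0 : (0 : K → ℝ) ∈ B) (s : ℝ) (φ : ℝ → ℝ) (y : K → ℝ) (v : B → ℝ) :
    ∃ b : B, Available s y b.1 ∧ ∀ b' : B, Available s y b'.1 →
      v b' - ∑ k, b'.1 k * φ (y k) ≤ v b - ∑ k, b.1 k * φ (y k) := by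
  classical
  obtain ⟨b, hb, hmax⟩ := Finset.exists_max_image
    (Finset.univ.filter fun b : B => Available s y b.1)
    (fun b => v b - ∑ k, b.1 k * φ (y k)) ⟨⟨0, h0⟩,
      Finset.mem_filter.2 ⟨Finset.mem_univ _, fun k hk => absurd rfl hk⟩⟩
  exact ⟨b, (Finset.mem_filter.1 hb).2, fun b' hb' => hmax b' (by simp [hb'])⟩

/-- A most profitable available bundle for a customer with valuation `v` at the prices `φ (y k)`. -/
noncomputable def bestBundle (h0 : (0 : K → ℝ) ∈ B) (s : ℝ) (φ : ℝ → ℝ) (y : K → ℝ)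
    (v : B → ℝ) : B :=
  (exists_best_bundle h0 s φ y v).choose

theorem bestBundle_available (h0 : (0 : K → ℝ) ∈ B) (s : ℝ) (φ : ℝ → ℝ) (y : K → ℝ)
    (v : B → ℝ) : Available s y (bestBundle h0 s φ y v).1 :=
  (exists_best_bundle h0 s φ y v).choose_spec.1

theorem le_bestBundle (h0 : (0 : K → ℝ) ∈ B) (s : ℝ) (φ : ℝ → ℝ) (y : K → ℝ)
    (v : B → ℝ) (b : B) (hb : Available s y b.1) :
    v b - ∑ k, b.1 k * φ (y k) ≤
      v (bestBundle h0 s φ y v) - ∑ k, (bestBundle h0 s φ y v).1 k * φ (y k) :=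
  (exists_best_bundle h0 s φ y v).choose_spec.2 b hb

/-- The utilization after serving the customers `l` with posted prices. -/
noncomputable def postedUsage (h0 : (0 : K → ℝ) ∈ B) (s : ℝ) (φ : ℝ → ℝ)
    (l : List (Customer B)) : K → ℝ :=
  l.foldl (fun y c => y + (bestBundle h0 s φ y c.val).1) 0

/-- The decision of the posted price algorithm for the last customer of `l`. -/
noncomputable def postedDecide (h0 : (0 : K → ℝ) ∈ B) (s : ℝ) (φ : ℝ → ℝ)
    (l : List (Customer B)) : B :=
  match l.getLast? with
  | none => ⟨0, h0⟩
  | some c => bestBundle h0 s φ (postedUsage h0 s φ l.dropLast) c.val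

theorem postedDecide_take (h0 : (0 : K → ℝ) ∈ B) (s : ℝ) (φ : ℝ → ℝ) (l : List (Customer B))
    {n : ℕ} (hn : n < l.length) :
    postedDecide h0 s φ (l.take (n + 1)) =
      bestBundle h0 s φ (postedUsage h0 s φ (l.take n)) (l[n]).val := by
  rw [List.take_succ_eq_append_getElem hn]
  simp only [postedDecide, List.getLast?_concat, List.dropLast_concat]

theorem postedUsage_take_succ (h0 : (0 : K → ℝ) ∈ B) (s : ℝ) (φ : ℝ → ℝ) (l : List (Customer B))
    {n : ℕ} (hn : n < l.length) :
    postedUsage h0 s φ (l.take (n + 1)) =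
      postedUsage h0 s φ (l.take n) + (postedDecide h0 s φ (l.take (n + 1))).1 := by
  rw [postedDecide_take h0 s φ l hn, List.take_succ_eq_append_getElem hn]
  rw [postedUsage, List.foldl_append]
  rfl

theorem usage_postedDecide (h0 : (0 : K → ℝ) ∈ B) (s : ℝ) (φ : ℝ → ℝ) (l : List (Customer B)) :
    usage (fun n : Fin l.length => postedDecide h0 s φ (l.take (n + 1))) =
      postedUsage h0 s φ l := by
  ext k
  have h : ∀ N ≤ l.length, ∑ n ∈ Finset.range N, (postedDecide h0 s φ (l.take (n + 1))).1 k =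
      postedUsage h0 s φ (l.take N) k := by
    intro N
    induction N with
    | zero => intro _; simp [postedUsage]
    | succ N ih =>
      intro hN
      rw [Finset.sum_range_succ, ih (by omega), postedUsage_take_succ h0 s φ l (by omega)]
      simp
  rw [usage, Fin.sum_univ_eq_sum_range (fun n => (postedDecide h0 s φ (l.take (n + 1))).1 k),
    h _ le_rfl, List.take_length]

variable (h0 : (0 : K → ℝ) ∈ B) {d T : ℝ} (hpos : ∀ b ∈ B, ∀ k, 0 ≤ b k)
  (hd : ∀ b ∈ B, ∀ k, b k ≤ d) (hT : 0 ≤ T) (φ : ℝ → ℝ) (l : List (Customer B))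

include hpos hd hT in
-- A sale happens only at utilization at most T - d and adds at most d, so it never passes T.
theorem postedUsage_mem (k : K) (n : ℕ) :
    postedUsage h0 (T - d) φ (l.take n) k ∈ Icc 0 T := by
  induction n with
  | zero => simp [postedUsage, hT]
  | succ n ih =>
    rcases lt_or_ge n l.length with hn | hn
    · rw [postedUsage_take_succ h0 _ φ l hn, postedDecide_take h0 _ φ l hn]
      set y := postedUsage h0 (T - d) φ (l.take n)
      have hb := bestBundle_available h0 (T - d) φ y (l[n]).val k
      have h1 := hpos _ (bestBundle h0 (T - d) φ y (l[n]).val).2 k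
      have h2 := hd _ (bestBundle h0 (T - d) φ y (l[n]).val).2 k
      rw [Pi.add_apply]
      refine ⟨by linarith [ih.1], ?_⟩
      by_cases h : (bestBundle h0 (T - d) φ y (l[n]).val).1 k = 0
      · rw [h, add_zero]; exact ih.2
      · linarith [hb h]
    · rw [List.take_of_length_le (by omega)]
      rwa [List.take_of_length_le hn] at ih

include hpos in
theorem postedUsage_mono (s : ℝ) (k : K) :
    Monotone fun n => postedUsage h0 s φ (l.take n) k := by
  refine monotone_nat_of_le_succ fun n => ?_
  rcases lt_or_ge n l.length with hn | hn
  · rw [postedUsage_take_succ h0 _ φ l hn, Pi.add_apply]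
    linarith [hpos _ (postedDecide h0 s φ (l.take (n + 1))).2 k]
  · rw [List.take_of_length_le (l := l) (i := n + 1) (by omega), List.take_of_length_le hn]

/-- The posted price algorithm, which stops selling a resource at the utilization `T - d`. -/
noncomputable def postedAlgorithm (pbar : ℝ) (hT1 : T ≤ 1) : OnlineAlgorithm pbar B where
  decide := postedDecide h0 (T - d) φ
  feasible l _ k := by
    rw [usage_postedDecide, ← List.take_length (l := l)]
    exact (postedUsage_mem h0 hpos hd hT φ l k _).2.trans hT1

end PostedPrices

/-- The revenue earned along a sequence of utilizations with small increments. -/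
theorem IsPricing.revenue_le_sum {f : ℝ → ℝ} {pbar α T : ℝ} {φ G : ℝ → ℝ}
    (h : IsPricing f pbar α T φ G) {d : ℝ} (hd : 0 ≤ d) {u : ℕ → ℝ} (hu0 : u 0 = 0)
    (hu : Monotone u) (huT : ∀ n, u n ≤ T) (hstep : ∀ n, u (n + 1) - u n ≤ d) (N : ℕ) :
    G (u N) ≤ ∑ n ∈ Finset.range N, (u (n + 1) - u n) * φ (u n) + d * φ T := by
  have hmem : ∀ n, u n ∈ Icc 0 T := fun n => ⟨hu0 ▸ hu (Nat.zero_le n), huT n⟩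
  have hT : T ∈ Icc 0 T := ⟨h.threshold_mem.1, le_rfl⟩
  -- Charging the price before a sale instead of the one after it loses at most d times the price
  -- increase, and these increases telescope.
  have key : G (u N) ≤ ∑ n ∈ Finset.range N, (u (n + 1) - u n) * φ (u n) +
      d * (φ (u N) - φ 0) := by
    induction N with
    | zero => simp [hu0, h.revenue_zero]
    | succ N ih =>
      have h1 := h.revenue_le _ (hmem N) _ (hmem (N + 1)) (hu N.le_succ)
      have h2 := h.mono (hmem N) (hmem (N + 1)) (hu N.le_succ)
      have h3 := hu N.le_succ
      rw [Finset.sum_range_succ]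
      nlinarith [hstep N]
  have := h.mono (hmem N) hT (huT N)
  nlinarith [h.nonneg]

theorem offlineOpt_le {K : Type*} [Fintype K] {f : ℝ → ℝ} {B : Finset (K → ℝ)}
    (h0 : (0 : K → ℝ) ∈ B) {l : List (Customer B)} {w : ℝ}
    (h : ∀ x : Fin l.length → B, (∀ k, usage x k ≤ 1) → welfare f l x ≤ w) :
    offlineOpt f l ≤ w := by
  refine csSup_le ⟨_, fun _ => ⟨0, h0⟩, fun k => by simp [usage], rfl⟩ ?_
  rintro _ ⟨x, hx, rfl⟩
  exact h x hx

theorem le_offlineOpt {K : Type*} [Fintype K] (f : ℝ → ℝ) {B : Finset (K → ℝ)}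
    {l : List (Customer B)} (x : Fin l.length → B) (hx : ∀ k, usage x k ≤ 1) :
    welfare f l x ≤ offlineOpt f l := by
  refine le_csSup (Finite.bddAbove ?_) ⟨x, hx, rfl⟩
  refine (finite_range fun x : Fin l.length → B => welfare f l x).subset ?_
  rintro _ ⟨x, -, rfl⟩
  exact ⟨x, rfl⟩

theorem usage_nonneg {K : Type*} {B : Finset (K → ℝ)} (hpos : ∀ b ∈ B, ∀ k, 0 ≤ b k) {N : ℕ}
    (x : Fin N → B) (k : K) : 0 ≤ usage x k :=
  Finset.sum_nonneg fun n _ => hpos _ (x n).2 k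

/-- The performance of the posted price algorithm. -/
theorem IsPricing.offlineOpt_le_mul {f : ℝ → ℝ} (hf : IsCost f) {pbar α T : ℝ} {φ G : ℝ → ℝ}
    (h : IsPricing f pbar α T φ G) {K : Type*} [Fintype K] {B : Finset (K → ℝ)}
    (h0 : (0 : K → ℝ) ∈ B) (hpos : ∀ b ∈ B, ∀ k, 0 ≤ b k) {d : ℝ} (hd0 : 0 ≤ d)
    (hd : ∀ b ∈ B, ∀ k, b k ≤ d) (l : List (Customer B)) (hl : IsInstance pbar l) :
    offlineOpt f l ≤ α * ((postedAlgorithm h0 hpos hd h.threshold_mem.1 φ pbar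
      h.threshold_mem.2).onlineWelfare f l + Fintype.card K * (2 * d * φ T)) := by
  have hT0 := h.threshold_mem.1
  have hT1 := h.threshold_mem.2
  have hTm : T ∈ Icc 0 T := ⟨hT0, le_rfl⟩
  have hα : 0 ≤ α := zero_le_one.trans h.one_le
  set y : ℕ → K → ℝ := fun n => postedUsage h0 (T - d) φ (l.take n) with hy
  set b : ℕ → B := fun n => postedDecide h0 (T - d) φ (l.take (n + 1)) with hb
  set N := l.length with hN
  have hym : ∀ n k, y n k ∈ Icc 0 T := fun n k => postedUsage_mem h0 hpos hd hT0 φ l k n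
  have hmono : ∀ k, Monotone fun n => y n k := postedUsage_mono h0 hpos φ l (T - d)
  have hy0 : ∀ k, y 0 k = 0 := fun k => by simp [hy, postedUsage]
  have hsucc : ∀ n < N, ∀ k, y (n + 1) k - y n k = (b n).1 k := fun n hn k => by
    simp only [hy, hb]
    rw [postedUsage_take_succ h0 _ φ l hn, Pi.add_apply]; ring
  have hstep : ∀ k n, y (n + 1) k - y n k ≤ d := fun k n => by
    rcases lt_or_ge n N with hn | hn
    · rw [hsucc n hn]; exact hd _ (b n).2 k
    · simp only [hy]
      rw [List.take_of_length_le (l := l) (i := n + 1) (by omega), List.take_of_length_le hn]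
      simpa using hd0
  have hφ0 : ∀ z ∈ Icc 0 T, 0 ≤ φ z := fun z hz =>
    h.nonneg.trans (h.mono ⟨le_rfl, hT0⟩ hz hz.1)
  set u : Fin N → ℝ := fun n => (l.get n).val (b n) - ∑ k, (b n).1 k * φ (y n k) with hu
  have hbest : ∀ (n : Fin N) (b' : B), Available (T - d) (y n) b'.1 →
      (l.get n).val b' - ∑ k, b'.1 k * φ (y n k) ≤ u n := fun n b' hb' => by
    have := le_bestBundle h0 (T - d) φ (y n) (l.get n).val b' hb'
    simp only [hu, hb]
    rw [postedDecide_take h0 (T - d) φ l n.2]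
    exact this
  have hu0 : ∀ n, 0 ≤ u n := fun n => by
    have := hbest n ⟨0, h0⟩ (by simp [Available])
    rw [(hl.2 (l.get n) (List.get_mem l n)).1 _ rfl] at this
    simpa using this
  -- Dual prices: the final posted price, raised to φ(T) ≥ p̄ for a resource no longer sold, so that
  -- no customer misses it.
  set π : K → ℝ := fun k => if y N k ≤ T - d then φ (y N k) else φ T with hπ
  have hπle : ∀ n : Fin N, ∀ k, φ (y n k) ≤ π k := fun n k => by
    simp only [hπ]
    split_ifs
    · exact h.mono (hym n k) (hym N k) (hmono k n.2.le)
    · exact h.mono (hym n k) hTm (hym n k).2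
  have hπ0 : ∀ k, 0 ≤ π k := fun k => by
    simp only [hπ]
    split_ifs
    exacts [hφ0 _ (hym N k), hφ0 _ hTm]
  have hdual : ∀ (n : Fin N) (b' : B), (l.get n).val b' - ∑ k, b'.1 k * π k ≤ u n := by
    intro n b'
    by_cases hb' : Available (T - d) (y n) b'.1
    · have : ∑ k, b'.1 k * φ (y n k) ≤ ∑ k, b'.1 k * π k :=
        Finset.sum_le_sum fun k _ => mul_le_mul_of_nonneg_left (hπle n k) (hpos _ b'.2 k)
      linarith [hbest n b' hb']
    -- An unavailable bundle contains a closed resource, whose dual price φ(T) ≥ p̄ already exceeds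
    -- or equals the per-unit value. Its dual surplus is therefore at most 0 ≤ uₙ.
    · simp only [Available, not_forall, not_le] at hb'
      obtain ⟨k, hk, hyk⟩ := hb'
      have h1 : π k = φ T := if_neg (not_le.2 (hyk.trans_le (hmono k n.2.le)))
      have h2 : 0 < b'.1 k := lt_of_le_of_ne (hpos _ b'.2 k) (Ne.symm hk)
      have h3 := (hl.2 (l.get n) (List.get_mem l n)).2 b' k hk
      rw [div_le_iff₀ h2] at h3
      have h4 : b'.1 k * π k ≤ ∑ k, b'.1 k * π k :=
        Finset.single_le_sum (f := fun k => b'.1 k * π k)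
          (fun j _ => mul_nonneg (hpos _ b'.2 j) (hπ0 j)) (Finset.mem_univ k)
      rw [h1] at h4
      nlinarith [hu0 n, h.pbar_le]
  have hprofit : ∀ k, profit f (π k) ≤ α * (∑ n : Fin N, (b n).1 k * φ (y n k) - f (y N k) +
      2 * d * φ T) := by
    intro k
    have hrev := h.revenue_le_sum hd0 (u := fun n => y n k) (hy0 k) (hmono k)
      (fun n => (hym n k).2) (hstep k) N
    have hsum : ∑ n ∈ Finset.range N, (y (n + 1) k - y n k) * φ (y n k) =
        ∑ n : Fin N, (b n).1 k * φ (y n k) := by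
      rw [Fin.sum_univ_eq_sum_range (fun n => (b n).1 k * φ (y n k))]
      exact Finset.sum_congr rfl fun n hn => by rw [hsucc n (Finset.mem_range.1 hn)]
    rw [hsum] at hrev
    have hdT : 0 ≤ d * φ T := mul_nonneg hd0 (hφ0 _ hTm)
    by_cases hk : y N k ≤ T - d
    · have h1 : π k = φ (y N k) := if_pos hk
      rw [h1]
      refine (h.profit_le _ (hym N k)).trans (mul_le_mul_of_nonneg_left ?_ hα)
      linarith
    -- The unsold rest T - y is less than d, so evaluating the revenue at T costs another d φ(T);
    -- hence the factor 2.
    · have h1 : π k = φ T := if_neg hk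
      rw [h1]
      refine (h.profit_le _ hTm).trans (mul_le_mul_of_nonneg_left ?_ hα)
      have h2 := h.revenue_le _ (hym N k) _ hTm (hym N k).2
      have h3 : f (y N k) ≤ f T := hf.mono ⟨(hym N k).1, (hym N k).2.trans hT1⟩ ⟨hT0, hT1⟩
        (hym N k).2
      have h4 : φ T * (T - y N k) ≤ φ T * d :=
        mul_le_mul_of_nonneg_left (by linarith [not_le.1 hk]) (hφ0 _ hTm)
      linarith
  have hwel : (postedAlgorithm h0 hpos hd hT0 φ pbar hT1).onlineWelfare f l =
      ∑ n, u n + ∑ k, (∑ n : Fin N, (b n).1 k * φ (y n k) - f (y N k)) := by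
    have h1 : ∀ k, usage (fun n : Fin l.length => postedDecide h0 (T - d) φ (l.take (n + 1))) k =
        y N k := fun k => by
      rw [usage_postedDecide]
      simp [hy, hN]
    simp only [OnlineAlgorithm.onlineWelfare, welfare, postedAlgorithm, h1, hu,
      Finset.sum_sub_distrib]
    rw [Finset.sum_comm (s := (Finset.univ : Finset K))]
    ring
  have hcard : ∑ _k : K, 2 * d * φ T = Fintype.card K * (2 * d * φ T) := by simp
  refine offlineOpt_le h0 fun x hx => ?_
  have hsu : ∑ n, u n ≤ α * ∑ n, u n :=
    le_mul_of_one_le_left (Finset.sum_nonneg fun n _ => hu0 n) h.one_le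
  -- Weak duality: add and subtract the payments at the prices π, then bound the customers' part by
  -- the surpluses and each resource's part by Young's inequality.
  calc welfare f l x
      = ∑ n, ((l.get n).val (x n) - ∑ k, (x n).1 k * π k) +
        ∑ k, (π k * usage x k - f (usage x k)) := by
        simp only [welfare, usage, Finset.sum_sub_distrib, Finset.mul_sum]
        rw [Finset.sum_comm (s := (Finset.univ : Finset K))]
        simp only [mul_comm (π _)]
        ring
    _ ≤ ∑ n, u n + ∑ k, α * (∑ n : Fin N, (b n).1 k * φ (y n k) - f (y N k) + 2 * d * φ T) :=
        add_le_add (Finset.sum_le_sum fun n _ => hdual n (x n)) (Finset.sum_le_sum fun k _ =>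
          (hf.mul_sub_le_profit _ ⟨usage_nonneg hpos x k, hx k⟩).trans (hprofit k))
    _ ≤ _ := by
        rw [hwel, ← Finset.mul_sum, Finset.sum_add_distrib, hcard]
        linarith

/-! ### From solutions of the boundary value problems to price functions -/

section Revenue

variable {f : ℝ → ℝ} {α T : ℝ} {φ : ℝ → ℝ}

/-- Along a solution of the differential equation, the scaled profit plus the cost has derivative
`φ`. -/
theorem IsCost.hasDerivAt_revenue (hf : IsCost f) (hα : α ≠ 0) {y : ℝ} (hy : y ∈ Ioo (0 : ℝ) 1)
    (hφ : marginal f 0 < φ y)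
    (hd : HasDerivAt φ (α * ((φ y - marginal f y) / supply f (φ y))) y) :
    HasDerivAt (fun y => profit f (φ y) / α + f y) (φ y) y := by
  have hs := (hf.supply_pos hφ).ne'
  have h := (((hf.profit_hasDerivAt (φ y)).comp y hd).div_const α).add (hf.hasDerivAt hy)
  refine h.congr_deriv ?_
  field_simp
  ring

theorem IsCost.continuousOn_revenue (hf : IsCost f) (hT : T ≤ 1) (hφ : ContinuousOn φ (Icc 0 T)) :
    ContinuousOn (fun y => profit f (φ y) / α + f y) (Icc 0 T) :=
  ((hf.profit_continuous.comp_continuousOn hφ).div_const α).add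
    (hf.diff.continuousOn.mono (Icc_subset_Icc_right hT))

/-- Strictly increasing solutions of the differential equation are price functions. The equation
may fail at one point `u`. -/
theorem IsCost.isPricing (hf : IsCost f) {pbar u : ℝ} (hα : 1 ≤ α) (hT : T ∈ Ioc (0 : ℝ) 1)
    (hφ : ContinuousOn φ (Icc 0 T)) (hmono : StrictMonoOn φ (Icc 0 T))
    (h0 : φ 0 = marginal f 0) (hp : pbar ≤ φ T) (hu : u ∈ Icc 0 T)
    (hd : ∀ y ∈ Ioo 0 T, y ≠ u →
      HasDerivAt φ (α * ((φ y - marginal f y) / supply f (φ y))) y) :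
    IsPricing f pbar α T φ fun y => profit f (φ y) / α + f y := by
  have hα0 : α ≠ 0 := by linarith
  set G : ℝ → ℝ := fun y => profit f (φ y) / α + f y with hG
  have hGc : ContinuousOn G (Icc 0 T) := hf.continuousOn_revenue hT.2 hφ
  have hGd : ∀ y ∈ Ioo 0 T, y ≠ u → HasDerivAt G (φ y) y := fun y hy hyu =>
    hf.hasDerivAt_revenue hα0 ⟨hy.1, hy.2.trans_le hT.2⟩
      (h0 ▸ hmono ⟨le_rfl, hT.1.le⟩ (Ioo_subset_Icc_self hy) hy.1) (hd y hy hyu)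
  -- The equation is not available at the dividing threshold `u`, so the mean value estimate is made
  -- on each side of `u` and the two pieces are added by monotonicity of φ.
  have key : ∀ y ∈ Icc 0 T, ∀ z ∈ Icc 0 T, y ≤ z → u ∉ Ioo y z →
      G z - G y ≤ φ z * (z - y) := by
    intro y hy z hz hyz hnu
    have hsub : Ioo y z ⊆ Ioo 0 T := Ioo_subset_Ioo hy.1 hz.2
    have hne : ∀ x ∈ Ioo y z, x ≠ u := fun x hx he => hnu (he ▸ hx)
    refine (convex_Icc y z).image_sub_le_mul_sub_of_deriv_le
      (hGc.mono (Icc_subset_Icc hy.1 hz.2)) ?_ ?_ y (by simp [hyz]) z (by simp [hyz]) hyz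
    · rw [interior_Icc]
      exact fun x hx => (hGd x (hsub hx) (hne x hx)).differentiableAt.differentiableWithinAt
    · rw [interior_Icc]
      intro x hx
      rw [(hGd x (hsub hx) (hne x hx)).deriv]
      exact hmono.monotoneOn (Ioo_subset_Icc_self (hsub hx)) hz hx.2.le
  refine ⟨hα, ⟨hT.1.le, hT.2⟩, hmono.monotoneOn, h0 ▸ hf.marginal_zero_nonneg, hp, ?_, ?_, ?_⟩
  · show profit f (φ 0) / α + f 0 = 0
    rw [h0, hf.profit_marginal_zero, hf.zero, zero_div, add_zero]
  · intro y hy z hz hyz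
    by_cases hyu : u ∈ Ioo y z
    · have h1 := key y hy u hu hyu.1.le (by simp)
      have h2 := key u hu z hz hyu.2.le (by simp)
      have h3 := hmono.monotoneOn hu hz hyu.2.le
      have h4 : φ u * (u - y) ≤ φ z * (u - y) :=
        mul_le_mul_of_nonneg_right h3 (by linarith [hyu.1])
      linarith
    · exact key y hy z hz hyz hyu
  · intro y _
    rw [add_sub_cancel_right, mul_div_cancel₀ _ hα0]

end Revenue

/-- Solutions of the boundary value problems are price functions. -/
theorem IsCost.exists_isPricing {f : ℝ → ℝ} (hf : IsCost f) {pbar α : ℝ}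
    (hp : marginal f 0 < pbar) (hα : 1 ≤ α) (h : BVPSolvable f pbar α) :
    ∃ T φ G, IsPricing f pbar α T φ G := by
  obtain ⟨φ, ⟨hp1, hmono, hc, hd, h0, hv⟩ | ⟨hp1, hmono, u, hu, ⟨hc1, hd1, h0, hu1⟩,
    hc2, hd2, hu2, hv⟩⟩ := h
  · have hs := hf.supply_eq_marginalInv ⟨hp.le, hp1⟩
    rw [← hs] at hmono hc hd hv
    have hT : supply f pbar ∈ Ioc (0 : ℝ) 1 := ⟨hf.supply_pos hp, (hf.supply_mem pbar).2⟩
    refine ⟨_, φ, _, hf.isPricing hα hT hc hmono h0 hv (u := 0) ⟨le_rfl, hT.1.le⟩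
      fun y hy _ => ?_⟩
    obtain ⟨h1, h2⟩ := hd y hy
    rw [hf.image_marginal] at h1
    rwa [hf.supply_eq_marginalInv h1]
  · have hc : ContinuousOn φ (Icc 0 1) := by
      rw [← Icc_union_Icc_eq_Icc hu.1.le hu.2.le]
      exact hc1.union_of_isClosed hc2 isClosed_Icc isClosed_Icc
    refine ⟨1, φ, _, hf.isPricing hα (by simp) hc hmono h0 hv (Ioo_subset_Icc_self hu)
      fun y hy hyu => ?_⟩
    rcases lt_or_gt_of_ne hyu with h | h
    · obtain ⟨h1, h2⟩ := hd1 y ⟨hy.1, h⟩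
      rw [hf.image_marginal] at h1
      rwa [hf.supply_eq_marginalInv h1]
    · have h1 : marginal f 1 ≤ φ y :=
        hu2 ▸ (hmono (Ioo_subset_Icc_self hu) (Ioo_subset_Icc_self hy) h).le
      simpa [hf.supply_of_ge h1] using hd2 y ⟨h, hy.2⟩

/-! ### Achievability, including the infimum itself -/

section Achievability

variable {K : Type*} [Fintype K]

/-- A competitive guarantee with additive error `e`. -/
def Guarantee (f : ℝ → ℝ) {pbar : ℝ} {B : Finset (K → ℝ)} (α : ℝ) (A : OnlineAlgorithm pbar B)
    (e : ℝ) : Prop :=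
  ∀ l : List (Customer B), IsInstance pbar l →
    1 / α * offlineOpt f l - e ≤ A.onlineWelfare f l

theorem Guarantee.mono {f : ℝ → ℝ} {pbar : ℝ} {B : Finset (K → ℝ)} {α : ℝ}
    {A : OnlineAlgorithm pbar B} {e e' : ℝ} (h : Guarantee f α A e) (he : e ≤ e') :
    Guarantee f α A e' := fun l hl => by linarith [h l hl]

theorem Setup.isCost {K : Type*} (S : Setup K) : IsCost S.f :=
  ⟨S.f_diff, S.f_strictConvex, S.f_mono, S.f_zero⟩

/-- Algorithms for the different errors can be combined to one algorithm. -/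
theorem Setup.achievable_of_forall (S : Setup K) {α : ℝ} (hα : 1 ≤ α)
    (h : ∀ ε : ℝ, 0 < ε → ∀ᶠ m in atTop, ∃ A : OnlineAlgorithm S.pbar (S.bundles m),
      Guarantee S.f α A ε) : S.Achievable α := by
  -- The algorithms must not depend on ε, so for each m one is chosen whose error is within 1/(m+1)
  -- of the best possible; any other algorithm with error at most ε/2 then bounds it.
  set E : ℕ → Set ℝ := fun m =>
    {e | 0 ≤ e ∧ ∃ A : OnlineAlgorithm S.pbar (S.bundles m), Guarantee S.f α A e} with hE
  have hA : ∀ m, ∃ A : OnlineAlgorithm S.pbar (S.bundles m),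
      (E m).Nonempty → Guarantee S.f α A (sInf (E m) + 1 / (m + 1)) := by
    intro m
    by_cases hm : (E m).Nonempty
    · obtain ⟨e, ⟨-, A, hA⟩, he⟩ := exists_lt_of_csInf_lt hm
        (lt_add_of_pos_right (sInf (E m)) (Nat.one_div_pos_of_nat (α := ℝ) (n := m)))
      exact ⟨A, fun _ => hA.mono he.le⟩
    · exact ⟨⟨fun _ => ⟨0, S.empty_mem m⟩, fun l _ k => by simp [usage]⟩, fun h => absurd h hm⟩
  choose A hA using hA
  refine ⟨hα, A, fun ε hε => ?_⟩
  have h1 : ∀ᶠ m : ℕ in atTop, 1 / ((m : ℝ) + 1) < ε / 2 :=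
    tendsto_one_div_add_atTop_nhds_zero_nat.eventually (Iio_mem_nhds (half_pos hε))
  filter_upwards [h (ε / 2) (half_pos hε), h1] with m hm hm1
  have hmem : ε / 2 ∈ E m := ⟨(half_pos hε).le, hm⟩
  have h2 : sInf (E m) ≤ ε / 2 := csInf_le ⟨0, fun e he => he.1⟩ hmem
  exact (hA m ⟨_, hmem⟩).mono (by linarith)

/-- The optimal offline welfare is bounded. -/
theorem offlineOpt_le_card {f : ℝ → ℝ} (hf : IsCost f) {pbar : ℝ} (hp : 0 ≤ pbar)
    {B : Finset (K → ℝ)} (h0 : (0 : K → ℝ) ∈ B) (hpos : ∀ b ∈ B, ∀ k, 0 ≤ b k)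
    (l : List (Customer B)) (hl : IsInstance pbar l) :
    offlineOpt f l ≤ Fintype.card K * pbar := by
  refine offlineOpt_le h0 fun x hx => ?_
  have h1 : ∀ n, (l.get n).val (x n) ≤ ∑ k, pbar * (x n).1 k := by
    intro n
    have hnn : ∀ k, 0 ≤ pbar * (x n).1 k := fun k => mul_nonneg hp (hpos _ (x n).2 k)
    by_cases hx0 : (x n).1 = 0
    · rw [(hl.2 _ (List.get_mem l n)).1 _ hx0]
      exact Finset.sum_nonneg fun k _ => hnn k
    · obtain ⟨k, hk⟩ := Function.ne_iff.1 hx0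
      have h2 : 0 < (x n).1 k := lt_of_le_of_ne (hpos _ (x n).2 k) (Ne.symm hk)
      have h3 := (hl.2 _ (List.get_mem l n)).2 (x n) k hk
      rw [div_le_iff₀ h2] at h3
      exact h3.trans (Finset.single_le_sum (f := fun k => pbar * (x n).1 k)
        (fun j _ => hnn j) (Finset.mem_univ k))
  calc welfare f l x ≤ ∑ n, (l.get n).val (x n) := by
        refine sub_le_self _ (Finset.sum_nonneg fun k _ => ?_)
        exact hf.nonneg ⟨usage_nonneg hpos x k, hx k⟩
    _ ≤ ∑ n, ∑ k, pbar * (x n).1 k := Finset.sum_le_sum fun n _ => h1 n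
    _ = ∑ k, pbar * usage x k := by
        rw [Finset.sum_comm]
        simp only [usage, Finset.mul_sum]
    _ ≤ ∑ _k : K, pbar := Finset.sum_le_sum fun k _ => mul_le_of_le_one_right hp (hx k)
    _ = _ := by simp

theorem Setup.pbar_pos {K : Type*} (S : Setup K) : 0 < S.pbar :=
  S.isCost.marginal_zero_nonneg.trans_lt S.lt_pbar

/-- Price functions give algorithms with small error. -/
theorem Setup.eventually_guarantee (S : Setup K) {α T : ℝ} {φ G : ℝ → ℝ}
    (h : IsPricing S.f S.pbar α T φ G) {ε : ℝ} (hε : 0 < ε) :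
    ∀ᶠ m in atTop, ∃ A : OnlineAlgorithm S.pbar (S.bundles m), Guarantee S.f α A ε := by
  have hφT : 0 < φ T := S.pbar_pos.trans_le h.pbar_le
  have hC : (0 : ℝ) ≤ Fintype.card K * (2 * φ T) := by positivity
  set C : ℝ := Fintype.card K * (2 * φ T) with hCdef
  have hd : 0 < ε / (C + 1) := by positivity
  filter_upwards [S.small _ hd] with m hm
  have hα : 0 < α := zero_lt_one.trans_le h.one_le
  refine ⟨postedAlgorithm (S.empty_mem m) (S.nonneg m) hm h.threshold_mem.1 φ S.pbar
    h.threshold_mem.2, fun l hl => ?_⟩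
  have := h.offlineOpt_le_mul S.isCost (S.empty_mem m) (S.nonneg m) hd.le hm l hl
  have h1 : 1 / α * offlineOpt S.f l ≤ _ :=
    (mul_le_mul_of_nonneg_left this (by positivity)).trans_eq
      (by rw [← mul_assoc, one_div_mul_cancel hα.ne', one_mul])
  have h2 : Fintype.card K * (2 * (ε / (C + 1)) * φ T) ≤ ε := by
    calc (Fintype.card K : ℝ) * (2 * (ε / (C + 1)) * φ T) = C / (C + 1) * ε := by
          rw [hCdef]; ring
      _ ≤ 1 * ε := by
          refine mul_le_mul_of_nonneg_right ?_ hε.le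
          rw [div_le_one (by positivity)]
          linarith
      _ = ε := one_mul _
  linarith

/-- The set of achievable ratios contains the limits from above of ratios for which the boundary
value problems are solvable. -/
theorem Setup.achievable_of_bvpSolvable (S : Setup K) {a : ℝ} (ha : 1 ≤ a)
    (h : ∀ b, a < b → ∃ α, α < b ∧ a ≤ α ∧ BVPSolvable S.f S.pbar α) : S.Achievable a := by
  refine S.achievable_of_forall ha fun ε hε => ?_
  set C : ℝ := Fintype.card K * S.pbar with hC
  have hC0 : 0 ≤ C := mul_nonneg (by positivity) S.pbar_pos.le
  have ha0 : 0 < a := zero_lt_one.trans_le ha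
  obtain ⟨α, hαb, haα, hα⟩ := h (a + ε / (2 * (C + 1)))
    (lt_add_of_pos_right a (by positivity))
  obtain ⟨T, φ, G, hφ⟩ := S.isCost.exists_isPricing S.lt_pbar (ha.trans haα) hα
  filter_upwards [S.eventually_guarantee hφ (half_pos hε)] with m hm
  obtain ⟨A, hA⟩ := hm
  refine ⟨A, fun l hl => ?_⟩
  have h1 := hA l hl
  have h2 := offlineOpt_le_card S.isCost S.pbar_pos.le (S.empty_mem m) (S.nonneg m) l hl
  have hα0 : 0 < α := ha0.trans_le haα
  have h3 : 0 ≤ 1 / a - 1 / α := sub_nonneg.2 (one_div_le_one_div_of_le ha0 haα)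
  -- The difference is (α - a)/(aα), and aα ≥ 1.
  have h4 : 1 / a - 1 / α ≤ ε / (2 * (C + 1)) := by
    rw [div_sub_div _ _ ha0.ne' hα0.ne', div_le_iff₀ (by positivity)]
    have : 1 ≤ a * α := one_le_mul_of_one_le_of_one_le ha (ha.trans haα)
    have h5 : 0 < ε / (2 * (C + 1)) := by positivity
    nlinarith
  have h5 : (1 / a - 1 / α) * offlineOpt S.f l ≤ ε / 2 := by
    calc (1 / a - 1 / α) * offlineOpt S.f l ≤ (1 / a - 1 / α) * C :=
          mul_le_mul_of_nonneg_left h2 h3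
      _ ≤ ε / (2 * (C + 1)) * C := mul_le_mul_of_nonneg_right h4 hC0
      _ = ε / 2 * (C / (C + 1)) := by field_simp
      _ ≤ ε / 2 * 1 := by
          refine mul_le_mul_of_nonneg_left ?_ (half_pos hε).le
          rw [div_le_one (by positivity)]
          linarith
      _ = ε / 2 := mul_one _
  linarith [sub_mul (1 / a) (1 / α) (offlineOpt S.f l)]

end Achievability

/-! ### The backward solution from `(supply f pbar, pbar)` -/

theorem nonpos_of_deriv_le_mul {w w' : ℝ → ℝ} {a b C : ℝ} (hw : ContinuousOn w (Icc a b))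
    (hw' : ∀ y ∈ Ico a b, HasDerivWithinAt w (w' y) (Ici y) y) (ha : w a ≤ 0)
    (h : ∀ y ∈ Ico a b, 0 < w y → w' y ≤ C * w y) {y : ℝ} (hy : y ∈ Icc a b) : w y ≤ 0 := by
  -- Grönwall by strict barriers: the exponent C + 1 makes the barrier grow strictly faster than `w`
  -- wherever they touch.
  have key : ∀ ε : ℝ, 0 < ε → w y ≤ ε * Real.exp ((C + 1) * (y - a)) := by
    intro ε hε
    refine image_le_of_deriv_right_lt_deriv_boundary (f' := w')
      (B := fun y => ε * Real.exp ((C + 1) * (y - a)))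
      (B' := fun y => ε * (Real.exp ((C + 1) * (y - a)) * (C + 1)))
      hw hw' ?_ (fun z => ?_) (fun z hz hzB => ?_) hy
    · simpa using ha.trans hε.le
    · have := (((hasDerivAt_id z).sub_const a).const_mul (C + 1)).exp.const_mul ε
      simpa using this
    · have hpos : 0 < ε * Real.exp ((C + 1) * (z - a)) := by positivity
      have := h z hz (hzB ▸ hpos)
      rw [hzB] at this
      linarith
  have hlim : Tendsto (fun ε : ℝ => ε * Real.exp ((C + 1) * (y - a))) (𝓝[>] 0) (𝓝 0) := by
    have : Tendsto (fun ε : ℝ => ε * Real.exp ((C + 1) * (y - a))) (𝓝 0)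
        (𝓝 (0 * Real.exp ((C + 1) * (y - a)))) := tendsto_id.mul_const _
    rw [zero_mul] at this
    exact this.mono_left nhdsWithin_le_nhds
  exact ge_of_tendsto hlim (by filter_upwards [self_mem_nhdsWithin] with ε hε using key ε hε)

/-- The price in `[f' 0, pbar]` at which the maximal profit is `x`. -/
noncomputable def priceOf (f : ℝ → ℝ) (pbar x : ℝ) : ℝ :=
  Function.invFunOn (profit f) (Icc (marginal f 0) pbar) x

namespace IsCost

variable {f : ℝ → ℝ} (hf : IsCost f) {pbar : ℝ} (hp : marginal f 0 < pbar)
include hf hp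

theorem marginal_supply_le : marginal f (supply f pbar) ≤ pbar := by
  rcases le_or_gt (marginal f 1) pbar with h | h
  · rwa [hf.supply_of_ge h]
  · rw [hf.supply_eq_marginalInv ⟨hp.le, h.le⟩, (hf.marginalInv_spec ⟨hp.le, h.le⟩).2]

theorem priceOf_spec {x : ℝ} (hx : x ∈ Icc 0 (profit f pbar)) :
    priceOf f pbar x ∈ Icc (marginal f 0) pbar ∧ profit f (priceOf f pbar x) = x := by
  have h : x ∈ profit f '' Icc (marginal f 0) pbar := by
    refine intermediate_value_Icc hp.le hf.profit_continuous.continuousOn ?_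
    rwa [hf.profit_marginal_zero]
  exact ⟨Function.invFunOn_mem h, Function.invFunOn_eq h⟩

theorem priceOf_profit {p : ℝ} (h : p ∈ Icc (marginal f 0) pbar) :
    priceOf f pbar (profit f p) = p := by
  have := hf.priceOf_spec hp ⟨hf.profit_nonneg h.1, hf.profit_mono h.2⟩
  exact hf.profit_strictMonoOn.injOn this.1.1 h.1 this.2

theorem priceOf_mono : MonotoneOn (priceOf f pbar) (Icc 0 (profit f pbar)) := by
  intro x hx x' hx' h
  have h1 := hf.priceOf_spec hp hx
  have h2 := hf.priceOf_spec hp hx'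
  rw [← h1.2, ← h2.2] at h
  exact (hf.profit_strictMonoOn.le_iff_le h1.1.1 h2.1.1).1 h

theorem marginal_mem {y : ℝ} (hy : y ∈ Icc 0 (supply f pbar)) :
    marginal f y ∈ Icc (marginal f 0) pbar := by
  have h1 : y ∈ Icc (0 : ℝ) 1 := ⟨hy.1, hy.2.trans (hf.supply_mem pbar).2⟩
  exact ⟨hf.marginal_strictMonoOn.monotoneOn (by simp) h1 hy.1,
    (hf.marginal_strictMonoOn.monotoneOn h1 (hf.supply_mem pbar) hy.2).trans
      (hf.marginal_supply_le hp)⟩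

/-- The inverse of `profit` has slope 1/supply, and supply is at least `a` for prices from f'(a) on.
The constant blows up as a → 0: this is the singularity of the equation. -/
theorem priceOf_sub_le {a : ℝ} (ha : a ∈ Ioc 0 (supply f pbar)) {x x' : ℝ}
    (hx : x ∈ Icc (profit f (marginal f a)) (profit f pbar))
    (hx' : x' ∈ Icc (profit f (marginal f a)) (profit f pbar)) (h : x ≤ x') :
    priceOf f pbar x' - priceOf f pbar x ≤ 1 / a * (x' - x) := by
  have hma := hf.marginal_mem hp (Ioc_subset_Icc_self ha)
  have hδ := hf.profit_nonneg hma.1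
  have h1 := hf.priceOf_spec hp ⟨hδ.trans hx.1, hx.2⟩
  have h2 := hf.priceOf_spec hp ⟨hδ.trans hx'.1, hx'.2⟩
  have h3 := hf.priceOf_mono hp ⟨hδ.trans hx.1, hx.2⟩ ⟨hδ.trans hx'.1, hx'.2⟩ h
  have h4 := hf.priceOf_mono hp ⟨hδ, hx.1.trans hx.2⟩ ⟨hδ.trans hx.1, hx.2⟩ hx.1
  rw [hf.priceOf_profit hp hma] at h4
  have h5 := hf.supply_mono h4
  rw [hf.supply_marginal ⟨ha.1.le, ha.2.trans (hf.supply_mem pbar).2⟩] at h5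
  have h6 := hf.mul_supply_le_profit_sub (priceOf f pbar x) (priceOf f pbar x')
  rw [h1.2, h2.2] at h6
  rw [one_div, ← div_eq_inv_mul, le_div_iff₀ ha.1]
  nlinarith

theorem priceOf_lipschitzOnWith {a : ℝ} (ha : a ∈ Ioc 0 (supply f pbar)) :
    LipschitzOnWith (Real.toNNReal (1 / a)) (priceOf f pbar)
      (Icc (profit f (marginal f a)) (profit f pbar)) := by
  have hδ := hf.profit_nonneg (hf.marginal_mem hp (Ioc_subset_Icc_self ha)).1
  refine LipschitzOnWith.of_le_add_mul _ fun x hx x' hx' => ?_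
  rw [Real.coe_toNNReal _ (one_div_nonneg.2 ha.1.le), Real.dist_eq]
  rcases le_total x x' with h | h
  · have := hf.priceOf_mono hp ⟨hδ.trans hx.1, hx.2⟩ ⟨hδ.trans hx'.1, hx'.2⟩ h
    have h1 : 0 ≤ 1 / a * |x - x'| := mul_nonneg (one_div_nonneg.2 ha.1.le) (abs_nonneg _)
    linarith
  · have := hf.priceOf_sub_le hp ha hx' hx h
    rw [abs_of_nonneg (by linarith)]
    linarith

/-- The differential equation, in terms of the profit, with truncated right-hand side. -/
theorem exists_truncated_solution {α : ℝ} (hα : 0 < α) {a : ℝ} (ha : a ∈ Ioo 0 (supply f pbar)) :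
    ∃ x : ℝ → ℝ, x (supply f pbar) = profit f pbar ∧ ∀ y ∈ Icc a (supply f pbar),
      HasDerivWithinAt x (α * (priceOf f pbar
        (projIcc (profit f (marginal f a)) (profit f pbar)
          (hf.profit_mono (hf.marginal_mem hp (Ioo_subset_Icc_self ha)).2) (x y)) -
        marginal f y)) (Icc a (supply f pbar)) y := by
  have hma := hf.marginal_mem hp (Ioo_subset_Icc_self ha)
  have hδ := hf.profit_nonneg hma.1
  have hle := hf.profit_mono hma.2
  have hc := hf.marginal_zero_nonneg
  set T := supply f pbar with hT
  have hT1 : T ≤ 1 := (hf.supply_mem pbar).2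
  set κ : ℝ → ℝ := fun x =>
    priceOf f pbar (projIcc (profit f (marginal f a)) (profit f pbar) hle x) with hκ
  have hproj : ∀ x, ((projIcc (profit f (marginal f a)) (profit f pbar) hle x : ℝ)) ∈
    Icc (profit f (marginal f a)) (profit f pbar) := fun x => (projIcc _ _ hle x).2
  have hlip : LipschitzWith (Real.toNNReal (1 / a)) κ := by
    have h1 := (hf.priceOf_lipschitzOnWith hp ⟨ha.1, ha.2.le⟩).to_restrict.comp
      (LipschitzWith.projIcc hle)
    rw [mul_one] at h1
    exact h1
  set C : ℝ := α * pbar with hC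
  have hp0 : 0 ≤ pbar := hc.trans hp.le
  have hC0 : 0 ≤ C := mul_nonneg hα.le hp0
  -- The initial time is the right end point. Clamping `x` bounds the right-hand side by α p̄
  -- everywhere, so the solution reaches back to `a`.
  have hpl : IsPicardLindelof (fun t x => α * (κ x - marginal f t)) (tmin := a) (tmax := T)
      ⟨T, ha.2.le, le_rfl⟩ (profit f pbar) (Real.toNNReal (C * (T - a))) 0 (Real.toNNReal C)
      (Real.toNNReal α * Real.toNNReal (1 / a)) := by
    refine ⟨fun t _ => LipschitzWith.lipschitzOnWith ?_, fun x _ => ?_, fun t ht x _ => ?_, ?_⟩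
    · refine LipschitzWith.of_dist_le_mul fun x x' => ?_
      have := hlip.dist_le_mul x x'
      rw [Real.dist_eq] at this ⊢
      rw [← mul_sub, sub_sub_sub_cancel_right, abs_mul, abs_of_pos hα, NNReal.coe_mul,
        Real.coe_toNNReal _ hα.le, mul_assoc]
      exact mul_le_mul_of_nonneg_left this hα.le
    · exact continuousOn_const.mul (continuousOn_const.sub
        (hf.marginal_continuousOn.mono (Icc_subset_Icc ha.1.le hT1)))
    · have h1 := (hf.priceOf_spec hp ⟨hδ.trans (hproj x).1, (hproj x).2⟩).1
      have h2 := hf.marginal_mem hp (y := t) ⟨ha.1.le.trans ht.1, ht.2⟩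
      rw [Real.coe_toNNReal _ hC0, Real.norm_eq_abs, abs_mul, abs_of_pos hα]
      refine mul_le_mul_of_nonneg_left (abs_le.2 ⟨?_, ?_⟩) hα.le
      · linarith [h1.1, h2.2]
      · linarith [h1.2, h2.1]
    · rw [Real.coe_toNNReal _ hC0,
        Real.coe_toNNReal _ (mul_nonneg hC0 (sub_nonneg.2 ha.2.le))]
      simp [ha.2.le]
  obtain ⟨x, hx, hx'⟩ := hpl.exists_eq_forall_mem_Icc_hasDerivWithinAt₀
  exact ⟨x, hx, hx'⟩

/-- The backward solution through `(supply f pbar, pbar)`, away from the singularity at `0`. -/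
theorem exists_solution_Icc {α : ℝ} (hα : 0 < α) {a : ℝ} (ha : a ∈ Ioo 0 (supply f pbar)) :
    ∃ φ : ℝ → ℝ, φ (supply f pbar) = pbar ∧ ContinuousOn φ (Icc a (supply f pbar)) ∧
      (∀ y ∈ Icc a (supply f pbar), marginal f a ≤ φ y ∧ φ y ≤ pbar) ∧
      (∀ y ∈ Ico a (supply f pbar), marginal f y < φ y) ∧
      (∀ y ∈ Icc a (supply f pbar), HasDerivWithinAt (fun y => profit f (φ y))
        (α * (φ y - marginal f y)) (Icc a (supply f pbar)) y) ∧
      ∀ y ∈ Ioo a (supply f pbar),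
        HasDerivAt φ (α * ((φ y - marginal f y) / supply f (φ y))) y := by
  obtain ⟨x, hxT, hx⟩ := hf.exists_truncated_solution hp hα ha
  have hma := hf.marginal_mem hp (Ioo_subset_Icc_self ha)
  have hδ := hf.profit_nonneg hma.1
  have hle := hf.profit_mono hma.2
  have hlip := hf.priceOf_lipschitzOnWith hp ⟨ha.1, ha.2.le⟩
  set T := supply f pbar with hT
  set δ := profit f (marginal f a) with hδdef
  have hT1 : T ≤ 1 := (hf.supply_mem pbar).2
  have hI : ∀ y ∈ Icc a T, y ∈ Icc (0 : ℝ) 1 := fun y hy => ⟨ha.1.le.trans hy.1, hy.2.trans hT1⟩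
  set κ : ℝ → ℝ := fun x => priceOf f pbar (projIcc δ (profit f pbar) hle x) with hκ
  have hproj : ∀ x, ((projIcc δ (profit f pbar) hle x : ℝ)) ∈ Icc δ (profit f pbar) :=
    fun x => (projIcc _ _ hle x).2
  have hproj0 : ∀ x, ((projIcc δ (profit f pbar) hle x : ℝ)) ∈ Icc 0 (profit f pbar) :=
    fun x => ⟨hδ.trans (hproj x).1, (hproj x).2⟩
  have hκmono : Monotone κ := fun z z' h =>
    hf.priceOf_mono hp (hproj0 z) (hproj0 z') (monotone_projIcc hle h)
  have hκeq : ∀ z ∈ Icc δ (profit f pbar), κ z = priceOf f pbar z := fun z hz => by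
    simp only [hκ]
    rw [projIcc_of_mem hle hz]
  have hκlip : ∀ z z', z ≤ z' → κ z' - κ z ≤ 1 / a * (z' - z) := fun z z' h => by
    refine (hf.priceOf_sub_le hp ⟨ha.1, ha.2.le⟩ (hproj z) (hproj z')
      (monotone_projIcc hle h)).trans (mul_le_mul_of_nonneg_left ?_ (one_div_nonneg.2 ha.1.le))
    have h1 := (LipschitzWith.projIcc hle).dist_le_mul z' z
    rw [Subtype.dist_eq, Real.dist_eq, Real.dist_eq, NNReal.coe_one, one_mul,
      abs_of_nonneg (sub_nonneg.2 h)] at h1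
    exact (le_abs_self _).trans h1
  have hmM : ∀ y ∈ Icc a T, marginal f y ∈ Icc (marginal f a) pbar := fun y hy =>
    ⟨hf.marginal_strictMonoOn.monotoneOn (hI a ⟨le_rfl, ha.2.le⟩) (hI y hy) hy.1,
      (hf.marginal_mem hp ⟨ha.1.le.trans hy.1, hy.2⟩).2⟩
  have hβ : ∀ y ∈ Icc a T, profit f (marginal f y) ∈ Icc δ (profit f pbar) := fun y hy =>
    ⟨hf.profit_mono (hmM y hy).1, hf.profit_mono (hmM y hy).2⟩
  have hκβ : ∀ y ∈ Icc a T, κ (profit f (marginal f y)) = marginal f y := fun y hy => by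
    rw [hκeq _ (hβ y hy), hf.priceOf_profit hp ⟨hma.1.trans (hmM y hy).1, (hmM y hy).2⟩]
  have hxc : ContinuousOn x (Icc a T) := fun y hy => (hx y hy).continuousWithinAt
  -- The curve profit(f') is a barrier: if `x` were on or below it at y < T, then, f' being
  -- increasing, `x` could never again exceed x(y), and so could not reach profit(p̄) at T.
  have hxβ : ∀ y ∈ Ico a T, profit f (marginal f y) < x y := by
    intro y hy
    by_contra! hcon
    have hyI := Ico_subset_Icc_self hy
    have hsub : Icc y T ⊆ Icc a T := Icc_subset_Icc_left hy.1
    have h1 := nonpos_of_deriv_le_mul (w := fun z => x z - x y)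
      (w' := fun z => α * (κ (x z) - marginal f z)) (C := α * (1 / a))
      ((hxc.mono hsub).sub continuousOn_const)
      (fun z hz => (((hx z (hsub (Ico_subset_Icc_self hz))).mono hsub).mono_of_mem_nhdsWithin
        (Icc_mem_nhdsGE_of_mem hz)).sub_const _) (by simp) ?_ (right_mem_Icc.2 hy.2.le)
    · have h2 : marginal f y < pbar :=
        (hf.marginal_strictMonoOn (hI y hyI) (hf.supply_mem pbar) hy.2).trans_le
          (hf.marginal_supply_le hp)
      have h3 := hf.profit_strictMonoOn (hma.1.trans (hmM y hyI).1) hp.le h2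
      simp only [hxT] at h1
      linarith
    · intro z hz hpos
      have hzI := hsub (Ico_subset_Icc_self hz)
      have h2 := hκmono hcon
      rw [hκβ y hyI] at h2
      have h3 := hf.marginal_strictMonoOn.monotoneOn (hI y hyI) (hI z hzI) hz.1
      have h4 := hκlip (x y) (x z) (by linarith)
      rw [mul_assoc]
      exact mul_le_mul_of_nonneg_left (by linarith) hα.le
  have hxmono : MonotoneOn x (Icc a T) := by
    have hd : ∀ y ∈ Ioo a T, HasDerivAt x (α * (κ (x y) - marginal f y)) y := fun y hy =>
      (hx y (Ioo_subset_Icc_self hy)).hasDerivAt (Icc_mem_nhds hy.1 hy.2)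
    refine monotoneOn_of_deriv_nonneg (convex_Icc a T) hxc ?_ ?_
    · rw [interior_Icc]
      exact fun y hy => (hd y hy).differentiableAt.differentiableWithinAt
    · rw [interior_Icc]
      intro y hy
      rw [(hd y hy).deriv]
      have h1 := hκmono (hxβ y (Ioo_subset_Ico_self hy)).le
      rw [hκβ y (Ioo_subset_Icc_self hy)] at h1
      exact mul_nonneg hα.le (by linarith)
  have hTm : T ∈ Icc a T := ⟨ha.2.le, le_rfl⟩
  have hxmem : ∀ y ∈ Icc a T, x y ∈ Icc δ (profit f pbar) := by
    intro y hy
    refine ⟨?_, hxT ▸ hxmono hy hTm hy.2⟩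
    rcases eq_or_lt_of_le hy.2 with h | h
    · rw [h, hxT]; exact hle
    · exact (hβ y hy).1.trans (hxβ y ⟨hy.1, h⟩).le
  have hspec : ∀ y ∈ Icc a T, priceOf f pbar (x y) ∈ Icc (marginal f 0) pbar ∧
      profit f (priceOf f pbar (x y)) = x y := fun y hy =>
    hf.priceOf_spec hp ⟨hδ.trans (hxmem y hy).1, (hxmem y hy).2⟩
  have hlt : ∀ y ∈ Ico a T, marginal f y < priceOf f pbar (x y) := by
    intro y hy
    by_contra! hcon
    have h1 := hf.profit_mono hcon
    rw [(hspec y (Ico_subset_Icc_self hy)).2] at h1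
    exact (hxβ y hy).not_ge h1
  have hd : ∀ y ∈ Icc a T, HasDerivWithinAt x (α * (priceOf f pbar (x y) - marginal f y))
      (Icc a T) y := fun y hy => by
    rw [← hκeq _ (hxmem y hy)]
    exact hx y hy
  refine ⟨fun y => priceOf f pbar (x y), ?_, hlip.continuousOn.comp hxc hxmem, ?_, hlt, ?_, ?_⟩
  · simp only [hxT]
    exact hf.priceOf_profit hp ⟨hp.le, le_rfl⟩
  · intro y hy
    refine ⟨?_, (hspec y hy).1.2⟩
    have := hκmono (hxmem y hy).1
    rwa [hκβ a ⟨le_rfl, ha.2.le⟩, hκeq _ (hxmem y hy)] at this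
  · intro y hy
    exact (hd y hy).congr (fun z hz => (hspec z hz).2) (hspec y hy).2
  · intro y hy
    have hyI := Ioo_subset_Icc_self hy
    have hgt := hlt y (Ioo_subset_Ico_self hy)
    have hq0 : marginal f 0 < priceOf f pbar (x y) :=
      (hma.1.trans (hmM y hyI).1).trans_lt hgt
    -- Strictness on the right is needed because `priceOf` is an inverse only up to profit(p̄). If
    -- `x` reached that value early it would stay constant, against its positive derivative.
    have hxI : x y ∈ Ioo δ (profit f pbar) := by
      refine ⟨(hβ y hyI).1.trans_lt (hxβ y (Ioo_subset_Ico_self hy)),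
        lt_of_le_of_ne (hxmem y hyI).2 fun heq => ?_⟩
      obtain ⟨z, hz⟩ := exists_between hy.2
      have hzI : z ∈ Ioo a T := ⟨hy.1.trans hz.1, hz.2⟩
      have hconst : ∀ w ∈ Icc y T, x w = profit f pbar := fun w hw =>
        le_antisymm (hxmem w ⟨hyI.1.trans hw.1, hw.2⟩).2
          (heq ▸ hxmono hyI ⟨hyI.1.trans hw.1, hw.2⟩ hw.1)
      have h1 : HasDerivAt x 0 z := by
        refine (hasDerivAt_const z (profit f pbar)).congr_of_eventuallyEq ?_
        filter_upwards [Icc_mem_nhds hz.1 hz.2] with w hw using hconst w hw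
      have h2 := ((hd z (Ioo_subset_Icc_self hzI)).hasDerivAt
        (Icc_mem_nhds hzI.1 hzI.2)).unique h1
      have h3 := hlt z (Ioo_subset_Ico_self hzI)
      have h4 := mul_pos hα (sub_pos.2 h3)
      linarith
    have hk : HasDerivAt (priceOf f pbar) (supply f (priceOf f pbar (x y)))⁻¹ (x y) := by
      refine HasDerivAt.of_local_left_inverse
        (hlip.continuousOn.continuousAt (Icc_mem_nhds hxI.1 hxI.2))
        (hf.profit_hasDerivAt _) (hf.supply_pos hq0).ne' ?_
      filter_upwards [Icc_mem_nhds hxI.1 hxI.2] with z hz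
      exact (hf.priceOf_spec hp ⟨hδ.trans hz.1, hz.2⟩).2
    refine (hk.comp y ((hd y hyI).hasDerivAt (Icc_mem_nhds hy.1 hy.2))).congr_deriv ?_
    ring

/-- Uniqueness of backward solutions, away from the singularity. -/
theorem solution_unique {α : ℝ} {a : ℝ} (ha : a ∈ Ioc 0 (supply f pbar)) {φ ψ : ℝ → ℝ}
    (hT : φ (supply f pbar) = ψ (supply f pbar))
    (hφ : ∀ y ∈ Icc a (supply f pbar), marginal f a ≤ φ y ∧ φ y ≤ pbar)
    (hψ : ∀ y ∈ Icc a (supply f pbar), marginal f a ≤ ψ y ∧ ψ y ≤ pbar)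
    (hφd : ∀ y ∈ Icc a (supply f pbar), HasDerivWithinAt (fun y => profit f (φ y))
        (α * (φ y - marginal f y)) (Icc a (supply f pbar)) y)
    (hψd : ∀ y ∈ Icc a (supply f pbar), HasDerivWithinAt (fun y => profit f (ψ y))
        (α * (ψ y - marginal f y)) (Icc a (supply f pbar)) y) :
    EqOn φ ψ (Icc a (supply f pbar)) := by
  have hma := hf.marginal_mem hp (Ioc_subset_Icc_self ha)
  have hlip := hf.priceOf_lipschitzOnWith hp ha
  set T := supply f pbar with hTdef
  have hk : ∀ χ : ℝ → ℝ, (∀ y ∈ Icc a T, marginal f a ≤ χ y ∧ χ y ≤ pbar) → ∀ y ∈ Icc a T,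
      priceOf f pbar (profit f (χ y)) = χ y := fun χ hχ y hy =>
    hf.priceOf_profit hp ⟨hma.1.trans (hχ y hy).1, (hχ y hy).2⟩
  have hs : ∀ χ : ℝ → ℝ, (∀ y ∈ Icc a T, marginal f a ≤ χ y ∧ χ y ≤ pbar) → ∀ y ∈ Ioc a T,
      profit f (χ y) ∈ Icc (profit f (marginal f a)) (profit f pbar) := fun χ hχ y hy =>
    ⟨hf.profit_mono (hχ y (Ioc_subset_Icc_self hy)).1,
      hf.profit_mono (hχ y (Ioc_subset_Icc_self hy)).2⟩
  have key := ODE_solution_unique_of_mem_Icc_left (a := a) (b := T)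
    (v := fun t x => α * (priceOf f pbar x - marginal f t))
    (K := Real.toNNReal |α| * Real.toNNReal (1 / a))
    (s := fun _ => Icc (profit f (marginal f a)) (profit f pbar))
    (f := fun y => profit f (φ y)) (g := fun y => profit f (ψ y)) ?_
    (fun y hy => (hφd y hy).continuousWithinAt) ?_ (hs φ hφ)
    (fun y hy => (hψd y hy).continuousWithinAt) ?_ (hs ψ hψ) (by simp [hT])
  · intro y hy
    have h1 := key hy
    simp only at h1
    rw [← hk φ hφ y hy, h1, hk ψ hψ y hy]
  · intro t _
    refine LipschitzOnWith.of_dist_le_mul fun x hx x' hx' => ?_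
    have := hlip.dist_le_mul x hx x' hx'
    rw [Real.dist_eq] at this ⊢
    rw [← mul_sub, sub_sub_sub_cancel_right, abs_mul, NNReal.coe_mul,
      Real.coe_toNNReal _ (abs_nonneg α), mul_assoc]
    exact mul_le_mul_of_nonneg_left this (abs_nonneg α)
  · intro y hy
    rw [hk φ hφ y (Ioc_subset_Icc_self hy)]
    exact (hφd y (Ioc_subset_Icc_self hy)).mono_of_mem_nhdsWithin (Icc_mem_nhdsLE_of_mem hy)
  · intro y hy
    rw [hk ψ hψ y (Ioc_subset_Icc_self hy)]
    exact (hψd y (Ioc_subset_Icc_self hy)).mono_of_mem_nhdsWithin (Icc_mem_nhdsLE_of_mem hy)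

/-- The backward solution through `(supply f pbar, pbar)` on the half-open interval. -/
theorem exists_solution_Ioc {α : ℝ} (hα : 0 < α) :
    ∃ ψ : ℝ → ℝ, ψ (supply f pbar) = pbar ∧ ContinuousOn ψ (Ioc 0 (supply f pbar)) ∧
      ∀ y ∈ Ioo 0 (supply f pbar), marginal f y < ψ y ∧
        HasDerivAt ψ (α * ((ψ y - marginal f y) / supply f (ψ y))) y := by
  have hT0 := hf.supply_pos hp
  have hT1 : supply f pbar ≤ 1 := (hf.supply_mem pbar).2
  choose! Φ hΦT hΦc hΦb hΦlt hΦd hΦ using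
    fun a (ha : a ∈ Ioo 0 (supply f pbar)) => hf.exists_solution_Icc hp hα ha
  set T := supply f pbar with hT
  have huniq : ∀ a ∈ Ioo 0 T, ∀ b ∈ Ioo 0 T, a ≤ b → EqOn (Φ a) (Φ b) (Icc b T) := by
    intro a ha b hb hab
    have hsub : Icc b T ⊆ Icc a T := Icc_subset_Icc_left hab
    refine hf.solution_unique hp (α := α) ⟨hb.1, hb.2.le⟩ ((hΦT a ha).trans (hΦT b hb).symm)
      (fun y hy => ⟨?_, (hΦb a ha y (hsub hy)).2⟩) (hΦb b hb)
      (fun y hy => (hΦd a ha y (hsub hy)).mono hsub) (hΦd b hb)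
    have h1 : marginal f b ≤ marginal f y := hf.marginal_strictMonoOn.monotoneOn
      ⟨hb.1.le, hb.2.le.trans hT1⟩ ⟨hb.1.le.trans hy.1, hy.2.trans hT1⟩ hy.1
    rcases eq_or_lt_of_le hy.2 with h | h
    · rw [h, hΦT a ha]
      exact (hf.marginal_mem hp ⟨hb.1.le, hb.2.le⟩).2
    · exact h1.trans (hΦlt a ha y ⟨hab.trans hy.1, h⟩).le
  -- Gluing: any left end below y gives the same value at y by uniqueness, and y/2 is one that works
  -- near y too.
  obtain ⟨ψ, hψ⟩ : ∃ ψ : ℝ → ℝ, ∀ y, ψ y = Φ (y / 2) y := ⟨_, fun _ => rfl⟩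
  have hhalf : ∀ y ∈ Ioc 0 T, y / 2 ∈ Ioo 0 T := fun y hy =>
    ⟨half_pos hy.1, (half_lt_self hy.1).trans_le hy.2⟩
  have heq : ∀ a ∈ Ioo 0 T, EqOn ψ (Φ a) (Icc a T) := by
    intro a ha y hy
    rw [hψ]
    have hy0 : 0 < y := ha.1.trans_le hy.1
    have hh := hhalf y ⟨hy0, hy.2⟩
    rcases le_total a (y / 2) with h | h
    · exact (huniq a ha _ hh h ⟨(half_lt_self hy0).le, hy.2⟩).symm
    · exact huniq _ hh a ha h hy
  have hψT : ψ T = pbar := (hψ T).trans <| hΦT _ (hhalf T ⟨hT0, le_rfl⟩)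
  refine ⟨ψ, hψT, ?_, ?_⟩
  · intro y hy
    have hh := hhalf y hy
    have h1 : ContinuousWithinAt ψ (Icc (y / 2) T) y :=
      ((hΦc _ hh).congr (heq _ hh)) y ⟨(half_lt_self hy.1).le, hy.2⟩
    refine h1.mono_of_mem_nhdsWithin ?_
    filter_upwards [self_mem_nhdsWithin, mem_nhdsWithin_of_mem_nhds
      (Ioi_mem_nhds (half_lt_self hy.1))] with z hz hz'
    exact ⟨le_of_lt hz', hz.2⟩
  · intro y hy
    have hh := hhalf y ⟨hy.1, hy.2.le⟩
    have hyh : y ∈ Ioo (y / 2) T := ⟨half_lt_self hy.1, hy.2⟩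
    rw [hψ y]
    refine ⟨hΦlt _ hh y ⟨hyh.1.le, hyh.2⟩, (hΦ _ hh y hyh).congr_of_eventuallyEq ?_⟩
    filter_upwards [Icc_mem_nhds hyh.1 hyh.2] with z hz using heq _ hh hz

/-- The backward solution through `(supply f pbar, pbar)`. It need not start at `f' 0`. -/
theorem exists_solution {α : ℝ} (hα : 0 < α) :
    ∃ φ : ℝ → ℝ, φ (supply f pbar) = pbar ∧ ContinuousOn φ (Icc 0 (supply f pbar)) ∧
      StrictMonoOn φ (Icc 0 (supply f pbar)) ∧ marginal f 0 ≤ φ 0 ∧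
      ∀ y ∈ Ioo 0 (supply f pbar), marginal f y < φ y ∧
        HasDerivAt φ (α * ((φ y - marginal f y) / supply f (φ y))) y := by
  obtain ⟨ψ, hψT, hψc, hd⟩ := hf.exists_solution_Ioc hp hα
  have hT0 := hf.supply_pos hp
  set T := supply f pbar with hT
  have hgt0 : ∀ y ∈ Ioo 0 T, marginal f 0 < ψ y := fun y hy =>
    (hf.marginal_mem hp (Ioo_subset_Icc_self hy)).1.trans_lt (hd y hy).1
  have hpos : ∀ y ∈ Ioo 0 T, 0 < α * ((ψ y - marginal f y) / supply f (ψ y)) := fun y hy =>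
    mul_pos hα (div_pos (sub_pos.2 (hd y hy).1) (hf.supply_pos (hgt0 y hy)))
  have hmono : StrictMonoOn ψ (Ioc 0 T) := by
    refine strictMonoOn_of_deriv_pos (convex_Ioc 0 T) hψc fun y hy => ?_
    rw [interior_Ioc] at hy
    rw [(hd y hy).2.deriv]
    exact hpos y hy
  -- The equation says nothing at 0, but a monotone function bounded below by f'(0) has a limit
  -- there.
  have hbdd : BddBelow (ψ '' Ioo 0 T) :=
    ⟨marginal f 0, by rintro _ ⟨y, hy, rfl⟩; exact (hgt0 y hy).le⟩
  have hlim0 : Tendsto ψ (𝓝[>] 0) (𝓝 (sInf (ψ '' Ioo 0 T))) :=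
    MonotoneOn.tendsto_nhdsWithin_Ioo_right (nonempty_Ioo.2 hT0)
      (hmono.monotoneOn.mono Ioo_subset_Ioc_self) hbdd
  have hlimT : Tendsto ψ (𝓝[<] T) (𝓝 pbar) := by
    have h1 : Tendsto ψ (𝓝[Ioc 0 T] T) (𝓝 (ψ T)) := hψc T ⟨hT0, le_rfl⟩
    rw [hψT] at h1
    refine h1.mono_left (nhdsWithin_le_of_mem ?_)
    exact mem_of_superset (Ioo_mem_nhdsLT hT0) Ioo_subset_Ioc_self
  set φ := extendFrom (Ioo 0 T) ψ with hφ
  have hφc : ContinuousOn φ (Icc 0 T) :=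
    continuousOn_Icc_extendFrom_Ioo (hψc.mono Ioo_subset_Ioc_self) hlim0 hlimT
  have hφψ : ∀ y ∈ Ioo 0 T, φ y = ψ y := fun y hy =>
    extendFrom_extends (hψc.mono Ioo_subset_Ioc_self) y hy
  have hφd : ∀ y ∈ Ioo 0 T, HasDerivAt φ (α * ((ψ y - marginal f y) / supply f (ψ y))) y := by
    intro y hy
    refine (hd y hy).2.congr_of_eventuallyEq ?_
    filter_upwards [Ioo_mem_nhds hy.1 hy.2] with z hz using hφψ z hz
  refine ⟨φ, eq_lim_at_right_extendFrom_Ioo hT0 hlimT, hφc, ?_, ?_, fun y hy => ?_⟩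
  · refine strictMonoOn_of_deriv_pos (convex_Icc 0 T) hφc fun y hy => ?_
    rw [interior_Icc] at hy
    rw [(hφd y hy).deriv]
    exact hpos y hy
  · rw [hφ, eq_lim_at_left_extendFrom_Ioo hT0 hlim0]
    refine le_csInf ((nonempty_Ioo.2 hT0).image _) ?_
    rintro _ ⟨y, hy, rfl⟩
    exact (hgt0 y hy).le
  · rw [hφψ y hy]
    exact ⟨(hd y hy).1, hφd y hy⟩

/-- A backward solution that starts at `f' 0` solves the boundary value problems. -/
theorem bvpSolvable_of_solution {α : ℝ} {φ : ℝ → ℝ} (hφT : φ (supply f pbar) = pbar)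
    (hc : ContinuousOn φ (Icc 0 (supply f pbar)))
    (hmono : StrictMonoOn φ (Icc 0 (supply f pbar))) (h0 : φ 0 = marginal f 0)
    (hd : ∀ y ∈ Ioo 0 (supply f pbar),
      HasDerivAt φ (α * ((φ y - marginal f y) / supply f (φ y))) y) :
    BVPSolvable f pbar α := by
  have hT0 := hf.supply_pos hp
  rcases le_or_gt pbar (marginal f 1) with h1 | h1
  · have hs := hf.supply_eq_marginalInv ⟨hp.le, h1⟩
    refine ⟨φ, Or.inl ⟨h1, hs ▸ hmono, hs ▸ hc, ?_, h0, hs ▸ hφT.ge⟩⟩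
    rw [← hs]
    intro y hy
    have hy1 : φ y ∈ Icc (marginal f 0) (marginal f 1) :=
      ⟨h0 ▸ (hmono ⟨le_rfl, hT0.le⟩ (Ioo_subset_Icc_self hy) hy.1).le,
        (hφT ▸ (hmono (Ioo_subset_Icc_self hy) ⟨hT0.le, le_rfl⟩ hy.2).le).trans h1⟩
    rw [hf.image_marginal, ← hf.supply_eq_marginalInv hy1]
    exact ⟨hy1, hd y hy⟩
  · rw [hf.supply_of_ge h1.le] at hφT hc hmono hd
    obtain ⟨u, hu, hu1⟩ : ∃ u ∈ Ioo (0 : ℝ) 1, φ u = marginal f 1 := by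
      have := intermediate_value_Ioo zero_le_one hc
      rw [h0, hφT] at this
      exact this ⟨hf.marginal_zero_lt_one, h1⟩
    have huI := Ioo_subset_Icc_self hu
    refine ⟨φ, Or.inr ⟨h1, hmono, u, hu, ⟨hc.mono (Icc_subset_Icc_right hu.2.le), ?_, h0, hu1⟩,
      hc.mono (Icc_subset_Icc_left hu.1.le), ?_, hu1, hφT.ge⟩⟩
    · intro y hy
      have hyI : y ∈ Ioo (0 : ℝ) 1 := ⟨hy.1, hy.2.trans hu.2⟩
      have hy1 : φ y ∈ Icc (marginal f 0) (marginal f 1) :=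
        ⟨h0 ▸ (hmono (by simp) (Ioo_subset_Icc_self hyI) hy.1).le,
          hu1 ▸ (hmono (Ioo_subset_Icc_self hyI) huI hy.2).le⟩
      rw [hf.image_marginal, ← hf.supply_eq_marginalInv hy1]
      exact ⟨hy1, hd y hyI⟩
    · intro y hy
      have hyI : y ∈ Ioo (0 : ℝ) 1 := ⟨hu.1.trans hy.1, hy.2⟩
      have hy1 : marginal f 1 ≤ φ y := hu1 ▸ (hmono huI (Ioo_subset_Icc_self hyI) hy.1).le
      simpa [hf.supply_of_ge hy1] using hd y hyI

end IsCost

/-! ### The lower bound: prices rising along the backward solution -/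

/-- If a backward solution `φ` starts above `f' 0`, then no sequence of utilizations can keep up
with prices rising along `φ`. -/
theorem IsCost.not_staircase {f : ℝ → ℝ} (hf : IsCost f) {pbar : ℝ} (hp : marginal f 0 < pbar)
    {α : ℝ} (hα : 0 < α) {φ : ℝ → ℝ} (hφT : φ (supply f pbar) = pbar)
    (hc : ContinuousOn φ (Icc 0 (supply f pbar)))
    (hmono : StrictMonoOn φ (Icc 0 (supply f pbar))) (h0 : marginal f 0 ≤ φ 0)
    (hd : ∀ y ∈ Ioo 0 (supply f pbar), marginal f y < φ y ∧
      HasDerivAt φ (α * ((φ y - marginal f y) / supply f (φ y))) y)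
    {M : ℕ} (hM : 0 < M) {e : ℝ} (he : e < profit f (φ 0) / α)
    (hstep : supply f pbar / M * pbar ≤ profit f (φ 0) / α - e) {p ψ : ℕ → ℝ}
    (hpφ : ∀ i, i ≤ M → p i = φ (i * (supply f pbar / M)))
    (hψ : ∀ i, i ≤ M → ψ i ∈ Icc (0 : ℝ) 1)
    (h : ∀ i, i ≤ M → profit f (p i) / α - e ≤
      p i * ψ i - ∑ j ∈ Finset.range i, ψ j * (p (j + 1) - p j) - f (ψ i)) : False := by
  have hT0 := hf.supply_pos hp
  have hTm := hf.supply_mem pbar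
  set T := supply f pbar with hT
  have hM0 : (0 : ℝ) < M := Nat.cast_pos.2 hM
  have hTM : 0 < T / M := div_pos hT0 hM0
  set y : ℕ → ℝ := fun i => i * (T / M) with hy
  have hyM : y M = T := by simp only [hy]; field_simp
  have hy0 : y 0 = 0 := by simp [hy]
  have hysucc : ∀ i, y (i + 1) = y i + T / M := fun i => by simp only [hy]; push_cast; ring
  have hymono : Monotone y := monotone_nat_of_le_succ fun i => by rw [hysucc]; linarith
  have hymem : ∀ i, i ≤ M → y i ∈ Icc 0 T := fun i hi =>
    ⟨hy0 ▸ hymono (Nat.zero_le i), hyM ▸ hymono hi⟩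
  have hymem1 : ∀ i, i ≤ M → y i ∈ Icc (0 : ℝ) 1 := fun i hi =>
    ⟨(hymem i hi).1, (hymem i hi).2.trans hTm.2⟩
  have hpy : ∀ i, i ≤ M → p i = φ (y i) := hpφ
  have hpM : p M = pbar := by rw [hpy M le_rfl, hyM, hφT]
  have hple : ∀ i, i ≤ M → p i ≤ pbar := fun i hi => by
    rw [hpy i hi, ← hφT]
    exact hmono.monotoneOn (hymem i hi) ⟨hT0.le, le_rfl⟩ (hymem i hi).2
  have hpmono : ∀ i, i < M → p i ≤ p (i + 1) := fun i hi => by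
    rw [hpy i hi.le, hpy (i + 1) hi]
    exact hmono.monotoneOn (hymem i hi.le) (hymem (i + 1) hi) (hymono i.le_succ)
  have hq : ∀ i, i ≤ M → marginal f (y i) ≤ p i := by
    intro i hi
    rw [hpy i hi]
    rcases eq_or_lt_of_le (hymem i hi).1 with h1 | h1
    · rwa [← h1]
    rcases eq_or_lt_of_le (hymem i hi).2 with h2 | h2
    · rw [h2, hφT]; exact hf.marginal_supply_le hp
    · exact (hd _ ⟨h1, h2⟩).1.le
  set G : ℝ → ℝ := fun y => profit f (φ y) / α + f y with hG
  have hGc : ContinuousOn G (Icc 0 T) := hf.continuousOn_revenue hTm.2 hc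
  have hGd : ∀ z ∈ Ioo 0 T, HasDerivAt G (φ z) z := fun z hz =>
    hf.hasDerivAt_revenue hα.ne' ⟨hz.1, hz.2.trans_le hTm.2⟩
      (h0.trans_lt (hmono ⟨le_rfl, hT0.le⟩ (Ioo_subset_Icc_self hz) hz.1)) (hd z hz).2
  have hGstep : ∀ i, i < M → p i * (y (i + 1) - y i) ≤ G (y (i + 1)) - G (y i) := by
    intro i hi
    have hsub : Ioo (y i) (y (i + 1)) ⊆ Ioo 0 T :=
      Ioo_subset_Ioo (hymem i hi.le).1 (hymem (i + 1) hi).2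
    have hle := hymono i.le_succ
    refine (convex_Icc (y i) (y (i + 1))).mul_sub_le_image_sub_of_le_deriv
      (hGc.mono (Icc_subset_Icc (hymem i hi.le).1 (hymem (i + 1) hi).2)) ?_ ?_
      _ (left_mem_Icc.2 hle) _ (right_mem_Icc.2 hle) hle
    · rw [interior_Icc]
      exact fun x hx => (hGd x (hsub hx)).differentiableAt.differentiableWithinAt
    · rw [interior_Icc]
      intro x hx
      rw [(hGd x (hsub hx)).deriv, hpy i hi.le]
      exact hmono.monotoneOn (hymem i hi.le) (Ioo_subset_Icc_self (hsub hx)) hx.1.le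
  -- Lower Riemann sums of φ = G', summed by parts; the start value G(0) = profit(φ(0))/α is the
  -- slack exploited below.
  have hGy : ∀ i, i ≤ M → profit f (φ 0) / α + p i * y i -
      ∑ j ∈ Finset.range i, y (j + 1) * (p (j + 1) - p j) ≤ G (y i) := by
    intro i
    induction i with
    | zero => intro _; simp [hy0, hG, hf.zero]
    | succ i ih =>
      intro hi
      rw [Finset.sum_range_succ]
      linarith [ih (by omega), hGstep i hi]
  -- Sales that were ahead so far only enlarge the subtracted sum, so the present profit must beat
  -- that at y i by the full slack.
  have key : ∀ i, i ≤ M → (∀ j, j < i → y (j + 1) ≤ ψ j) →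
      profit f (φ 0) / α - e + (p i * y i - f (y i)) ≤ p i * ψ i - f (ψ i) := by
    intro i hi hj
    have h1 : ∑ j ∈ Finset.range i, y (j + 1) * (p (j + 1) - p j) ≤
        ∑ j ∈ Finset.range i, ψ j * (p (j + 1) - p j) :=
      Finset.sum_le_sum fun j hj' => mul_le_mul_of_nonneg_right
        (hj j (Finset.mem_range.1 hj'))
        (sub_nonneg.2 (hpmono j (by have := Finset.mem_range.1 hj'; omega)))
    have h2 := hGy i hi
    have h3 := h i hi
    have h4 : G (y i) = profit f (p i) / α + f (y i) := by rw [hpy i hi]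
    linarith
  have hind : ∀ i, i < M → y (i + 1) ≤ ψ i := by
    intro i
    induction i using Nat.strong_induction_on with
    | _ i ih =>
      intro hi
      have h1 := key i hi.le fun j hj => ih j hj (hj.trans hi)
      -- Since f'(y i) ≤ p i, the tangent line shows that selling at most y i earns no more than
      -- selling y i. The slack, worth at least p̄ T/M, then forces a whole grid step ahead.
      have h2 : y i < ψ i := by
        by_contra! hcon
        have h3 := hf.tangent_le (hymem1 i hi.le) (hψ i hi.le)
        nlinarith [hq i hi.le]
      have h3 := hf.mono (hymem1 i hi.le) (hψ i hi.le) h2.le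
      have h4 : p i * (ψ i - y i) ≤ pbar * (ψ i - y i) :=
        mul_le_mul_of_nonneg_right (hple i hi.le) (by linarith)
      have hpb : 0 < pbar := hf.marginal_zero_nonneg.trans_lt hp
      have h5 : T / M ≤ ψ i - y i := by
        refine le_of_mul_le_mul_left ?_ hpb
        linarith
      rw [hysucc]
      linarith
  have h1 := key M le_rfl hind
  rw [hpM, hyM] at h1
  have h2 := hf.mul_sub_le_profit pbar (hψ M le_rfl)
  unfold profit at h2
  linarith

/-! ### Single-minded customers as hard instances -/

section Instance

variable {K : Type*} {B : Finset (K → ℝ)}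

open Classical in
/-- A customer who is interested in the bundle `b₀` only. -/
noncomputable def singleMinded (b₀ : B) (v : ℝ) : Customer B where
  time := 0
  val b := if b = b₀ then v else 0

/-- The first `N` single-minded customers with values `v 0, v 1, …`. -/
noncomputable def singleMindedList (b₀ : B) (v : ℕ → ℝ) (N : ℕ) : List (Customer B) :=
  (List.range N).map fun n => singleMinded b₀ (v n)

theorem length_singleMindedList (b₀ : B) (v : ℕ → ℝ) (N : ℕ) :
    (singleMindedList b₀ v N).length = N := by
  simp [singleMindedList]

theorem get_singleMindedList (b₀ : B) (v : ℕ → ℝ) (N : ℕ)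
    (n : Fin (singleMindedList b₀ v N).length) :
    (singleMindedList b₀ v N).get n = singleMinded b₀ (v n) := by
  rw [List.get_eq_getElem]
  simp [singleMindedList]

theorem lt_of_fin_singleMindedList {b₀ : B} {v : ℕ → ℝ} {N : ℕ}
    (n : Fin (singleMindedList b₀ v N).length) : (n : ℕ) < N :=
  n.2.trans_eq (length_singleMindedList b₀ v N)

theorem sum_fin_singleMindedList (b₀ : B) (v : ℕ → ℝ) (N : ℕ) (F : ℕ → ℝ) :
    ∑ n : Fin (singleMindedList b₀ v N).length, F n = ∑ n ∈ Finset.range N, F n := by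
  rw [Fin.sum_univ_eq_sum_range F, length_singleMindedList]

/-- Shorter instances are prefixes of longer ones, so an online algorithm makes the same sales in
all of them. This is what lets the adversary stop at any time. -/
theorem take_singleMindedList (b₀ : B) (v : ℕ → ℝ) {N n : ℕ} (h : n ≤ N) :
    (singleMindedList b₀ v N).take n = singleMindedList b₀ v n := by
  rw [singleMindedList, singleMindedList, ← List.map_take, List.take_range, min_eq_left h]

theorem isInstance_singleMindedList {pbar : ℝ} (hp : 0 ≤ pbar) {b₀ : B} {k₀ : K}
    (hb : 0 < b₀.1 k₀) (hb' : ∀ j, j ≠ k₀ → b₀.1 j = 0) {p : ℕ → ℝ} {N : ℕ}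
    (h : ∀ n, n < N → p n ≤ pbar) :
    IsInstance pbar (singleMindedList b₀ (fun n => p n * b₀.1 k₀) N) := by
  refine ⟨?_, fun c hc => ?_⟩
  · refine List.pairwise_iff_getElem.2 fun i j hi hj _ => ?_
    simp [singleMindedList, singleMinded]
  · obtain ⟨n, hn, rfl⟩ := List.mem_map.1 hc
    refine ⟨fun b h0 => ?_, fun b k hk => ?_⟩
    · refine if_neg ?_
      rintro rfl
      simp [h0] at hb
    · simp only [singleMinded]
      split_ifs with hbb
      · subst hbb
        obtain rfl : k = k₀ := by
          by_contra hne
          exact hk (hb' k hne)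
        rw [mul_div_cancel_right₀ _ hk]
        exact h n (List.mem_range.1 hn)
      · simpa using hp

open Classical in
/-- The amount sold to the `n`-th single-minded customer. -/
noncomputable def amountSold {pbar : ℝ} (A : OnlineAlgorithm pbar B) (b₀ : B) (k₀ : K)
    (v : ℕ → ℝ) (n : ℕ) : ℝ :=
  if A.decide (singleMindedList b₀ v (n + 1)) = b₀ then b₀.1 k₀ else 0

variable {pbar : ℝ} (A : OnlineAlgorithm pbar B) {b₀ : B} {k₀ : K}

theorem amountSold_nonneg (hb : 0 ≤ b₀.1 k₀) (v : ℕ → ℝ) (n : ℕ) :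
    0 ≤ amountSold A b₀ k₀ v n := by
  unfold amountSold
  split_ifs
  exacts [hb, le_rfl]

theorem sum_amountSold_le_usage (hpos : ∀ b ∈ B, ∀ k, 0 ≤ b k) (v : ℕ → ℝ) (N : ℕ) :
    ∑ n ∈ Finset.range N, amountSold A b₀ k₀ v n ≤
      usage (fun n : Fin (singleMindedList b₀ v N).length =>
        A.decide ((singleMindedList b₀ v N).take (n + 1))) k₀ := by
  have h1 : ∀ n : Fin (singleMindedList b₀ v N).length,
      (A.decide ((singleMindedList b₀ v N).take (n + 1))).1 k₀ =
        (A.decide (singleMindedList b₀ v (n + 1))).1 k₀ := fun n => by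
    rw [take_singleMindedList b₀ v (lt_of_fin_singleMindedList n)]
  rw [usage, Finset.sum_congr rfl fun n _ => h1 n,
    sum_fin_singleMindedList b₀ v N fun n => (A.decide (singleMindedList b₀ v (n + 1))).1 k₀]
  refine Finset.sum_le_sum fun n _ => ?_
  unfold amountSold
  split_ifs with h
  · rw [h]
  · exact hpos _ (A.decide _).2 k₀

variable [Fintype K]

/-- Any bundle other than `b₀` is worth nothing to these customers and can only add cost, so only
the sales of `b₀` count. -/
theorem onlineWelfare_singleMinded_le {f : ℝ → ℝ} (hf : IsCost f)
    (hpos : ∀ b ∈ B, ∀ k, 0 ≤ b k) {p : ℕ → ℝ} {N : ℕ}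
    (hl : IsInstance pbar (singleMindedList b₀ (fun n => p n * b₀.1 k₀) N)) :
    A.onlineWelfare f (singleMindedList b₀ (fun n => p n * b₀.1 k₀) N) ≤
      ∑ n ∈ Finset.range N, p n * amountSold A b₀ k₀ (fun n => p n * b₀.1 k₀) n -
      f (∑ n ∈ Finset.range N, amountSold A b₀ k₀ (fun n => p n * b₀.1 k₀) n) := by
  classical
  set v : ℕ → ℝ := fun n => p n * b₀.1 k₀ with hv
  have hus := sum_amountSold_le_usage A (b₀ := b₀) (k₀ := k₀) hpos v N
  have hfeas := A.feasible _ hl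
  have hval : ∀ n : Fin (singleMindedList b₀ v N).length,
      ((singleMindedList b₀ v N).get n).val
        (A.decide ((singleMindedList b₀ v N).take (n + 1))) =
      p n * amountSold A b₀ k₀ v n := fun n => by
    rw [take_singleMindedList b₀ v (lt_of_fin_singleMindedList n), get_singleMindedList, amountSold, singleMinded]
    simp [hv]
  unfold OnlineAlgorithm.onlineWelfare welfare
  rw [Finset.sum_congr rfl fun n _ => hval n,
    sum_fin_singleMindedList b₀ v N fun n => p n * amountSold A b₀ k₀ v n]
  refine sub_le_sub_left ?_ _
  refine le_trans ?_ (Finset.single_le_sum (fun k _ => hf.nonneg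
    ⟨usage_nonneg hpos _ k, hfeas k⟩) (Finset.mem_univ k₀))
  exact hf.mono ⟨Finset.sum_nonneg fun n _ => amountSold_nonneg A (hpos _ b₀.2 k₀) v n,
    hus.trans (hfeas k₀)⟩ ⟨usage_nonneg hpos _ k₀, hfeas k₀⟩ hus

/-- Offline, serve only customers of the last block, as many as fit into `supply f q`. Rounding down
loses the value of at most one bundle and does not raise the cost. -/
theorem profit_sub_le_offlineOpt {f : ℝ → ℝ} (hf : IsCost f) (h0 : (0 : K → ℝ) ∈ B)
    (hb : 0 < b₀.1 k₀) (hb' : ∀ j, j ≠ k₀ → b₀.1 j = 0) {v : ℕ → ℝ} {q : ℝ} (hq : 0 ≤ q)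
    {s t : ℕ} (hst : 1 / b₀.1 k₀ ≤ t) (hv : ∀ n, s ≤ n → n < s + t → v n = q * b₀.1 k₀) :
    profit f q - q * b₀.1 k₀ ≤ offlineOpt f (singleMindedList b₀ v (s + t)) := by
  classical
  set r := b₀.1 k₀ with hr
  have hg := hf.supply_mem q
  set j := ⌊supply f q / r⌋₊ with hj
  have hjr : (j : ℝ) * r ≤ supply f q := by
    rw [← le_div_iff₀ hb]
    exact Nat.floor_le (div_nonneg hg.1 hb.le)
  have hjr' : supply f q ≤ j * r + r := by
    have := (Nat.lt_floor_add_one (supply f q / r)).le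
    rw [div_le_iff₀ hb] at this
    linarith
  have hjt : j ≤ t := by
    have h1 : (j : ℝ) ≤ t := by
      refine le_trans ?_ hst
      rw [le_div_iff₀ hb]
      exact hjr.trans hg.2
    exact_mod_cast h1
  set l := singleMindedList b₀ v (s + t) with hl
  set x : ℕ → B := fun n => if n ∈ Finset.Ico s (s + j) then b₀ else ⟨0, h0⟩ with hx
  have hsub : Finset.Ico s (s + j) ⊆ Finset.range (s + t) := fun n hn => by
    rw [Finset.mem_Ico] at hn
    exact Finset.mem_range.2 (by omega)
  have hsum : ∀ c : ℝ, ∑ n ∈ Finset.range (s + t), (if n ∈ Finset.Ico s (s + j) then c else 0) =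
      j * c := fun c => by
    rw [Finset.sum_ite_mem, Finset.inter_eq_right.2 hsub]
    simp
  have husage : ∀ k, usage (fun n : Fin l.length => x n) k = j * b₀.1 k := fun k => by
    rw [usage, sum_fin_singleMindedList b₀ v _ fun n => (x n).1 k, ← hsum]
    refine Finset.sum_congr rfl fun n _ => ?_
    simp only [hx]
    split_ifs <;> rfl
  have hb0 : (⟨0, h0⟩ : B) ≠ b₀ := fun h => by
    rw [hr, ← h] at hb
    simp at hb
  have hval : ∀ n : Fin l.length, (l.get n).val (x n) =
      if (n : ℕ) ∈ Finset.Ico s (s + j) then q * r else 0 := fun n => by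
    rw [get_singleMindedList]
    by_cases h1 : (n : ℕ) ∈ Finset.Ico s (s + j)
    · have h2 : x n = b₀ := if_pos h1
      rw [if_pos h1, h2, singleMinded]
      rw [Finset.mem_Ico] at h1
      exact (if_pos rfl).trans (hv n h1.1 (by omega))
    · have h2 : x n = ⟨0, h0⟩ := if_neg h1
      rw [if_neg h1, h2, singleMinded]
      exact if_neg hb0
  have hwel : welfare f l (fun n => x n) = j * (q * r) - f (j * r) := by
    unfold welfare
    rw [Finset.sum_congr rfl fun n _ => hval n,
      sum_fin_singleMindedList b₀ v _ fun n => if n ∈ Finset.Ico s (s + j) then q * r else 0,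
      hsum, Finset.sum_eq_single k₀]
    · rw [husage]
    · intro k _ hk
      rw [husage, hb' k hk, mul_zero, hf.zero]
    · simp
  have hfeas : ∀ k, usage (fun n : Fin l.length => x n) k ≤ 1 := fun k => by
    rw [husage]
    by_cases hk : k = k₀
    · rw [hk]; exact hjr.trans hg.2
    · rw [hb' k hk, mul_zero]; exact zero_le_one
  refine le_trans ?_ (hwel ▸ le_offlineOpt f (fun n : Fin l.length => x n) hfeas)
  have h1 : f (j * r) ≤ f (supply f q) :=
    hf.mono ⟨by positivity, hjr.trans hg.2⟩ hg hjr
  have h2 : q * supply f q ≤ q * (j * r + r) := mul_le_mul_of_nonneg_left hjr' hq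
  unfold profit
  linarith

end Instance

/-- Summation by parts over blocks of constant price. -/
theorem sum_blocks_eq (p D : ℕ → ℝ) {R : ℕ} (hR : 0 < R) (i : ℕ) :
    ∑ n ∈ Finset.range (i * R + R), p (n / R) * D n =
      p i * ∑ n ∈ Finset.range (i * R + R), D n -
      ∑ j ∈ Finset.range i, (∑ n ∈ Finset.range (j * R + R), D n) * (p (j + 1) - p j) := by
  have hblock : ∀ i, ∑ t ∈ Finset.range R, p ((i * R + t) / R) * D (i * R + t) =
      p i * ∑ t ∈ Finset.range R, D (i * R + t) := fun i => by
    rw [Finset.mul_sum]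
    refine Finset.sum_congr rfl fun t ht => ?_
    rw [mul_comm i R, Nat.mul_add_div hR, Nat.div_eq_of_lt (Finset.mem_range.1 ht), add_zero]
  induction i with
  | zero => simpa using hblock 0
  | succ i ih =>
    have h1 : (i + 1) * R = i * R + R := by ring
    have h2 := hblock (i + 1)
    rw [h1] at h2
    rw [h1, Finset.sum_range_add, ih, h2, Finset.sum_range_add _ (i * R + R) R,
      Finset.sum_range_succ]
    ring

/-- Achievability of a competitive ratio makes the boundary value problems solvable. -/
theorem Setup.Achievable.bvpSolvable {K : Type*} [Fintype K] {S : Setup K} {α : ℝ}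
    (h : S.Achievable α) : BVPSolvable S.f S.pbar α := by
  obtain ⟨h1, A, hA⟩ := h
  have hf := S.isCost
  have hp := S.lt_pbar
  have hpb := S.pbar_pos
  have hα : 0 < α := zero_lt_one.trans_le h1
  obtain ⟨φ, hφT, hc, hmono, h0, hd⟩ := hf.exists_solution hp hα
  rcases eq_or_lt_of_le h0 with heq | hlt
  · exact hf.bvpSolvable_of_solution hp hφT hc hmono heq.symm fun y hy => (hd y hy).2
  exfalso
  have hT0 := hf.supply_pos hp
  have hη : 0 < profit S.f (φ 0) :=
    hf.profit_marginal_zero.symm.trans_lt (hf.profit_strictMonoOn self_mem_Ici h0 hlt)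
  set γ := profit S.f (φ 0) / α with hγ
  have hγ0 : 0 < γ := div_pos hη hα
  -- The slack γ is split in half: γ/2 covers one grid step at price p̄, and the rest is shared
  -- equally by the additive error of the algorithm and the rounding to whole bundles.
  obtain ⟨M, hM⟩ := exists_nat_gt (supply S.f S.pbar * S.pbar / (γ / 2))
  have hM0 : (0 : ℝ) < M := lt_of_le_of_lt (by positivity) hM
  have hMpos : 0 < M := by exact_mod_cast hM0
  rw [div_lt_iff₀ (half_pos hγ0)] at hM
  have hd0 : 0 < γ / (4 * S.pbar) := by positivity
  obtain ⟨m, hm, hsmall⟩ :=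
    ((hA (γ / 4) (by positivity)).and (S.small _ hd0)).exists
  obtain ⟨b, hbB, k₀, hb, hb'⟩ := S.single m
  set b₀ : S.bundles m := ⟨b, hbB⟩ with hb₀
  -- One block of R customers can fill the capacity on its own. Customer n belongs to block n / R.
  set R := ⌊1 / b k₀⌋₊ + 1 with hR
  have hRpos : 0 < R := Nat.succ_pos _
  have hR1 : 1 / b k₀ ≤ (R : ℕ) := by
    rw [hR]; push_cast; exact (Nat.lt_floor_add_one _).le
  set p : ℕ → ℝ := fun i => φ (i * (supply S.f S.pbar / M)) with hpdef
  have hmem : ∀ i, i ≤ M → (i : ℝ) * (supply S.f S.pbar / M) ∈ Icc 0 (supply S.f S.pbar) := by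
    intro i hi
    refine ⟨by positivity, ?_⟩
    rw [mul_div_left_comm]
    refine mul_le_of_le_one_right hT0.le ?_
    rw [div_le_one hM0]
    exact_mod_cast hi
  have hple : ∀ i, i ≤ M → p i ≤ S.pbar := fun i hi => by
    rw [← hφT]
    exact hmono.monotoneOn (hmem i hi) ⟨hT0.le, le_rfl⟩ (hmem i hi).2
  have hp0 : ∀ i, i ≤ M → 0 ≤ p i := fun i hi =>
    (hf.marginal_zero_nonneg.trans h0).trans
      (hmono.monotoneOn ⟨le_rfl, hT0.le⟩ (hmem i hi) (hmem i hi).1)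
  set D := amountSold (A m) b₀ k₀ (fun n => p (n / R) * b k₀) with hD
  have hinst : ∀ i, i ≤ M → IsInstance S.pbar
      (singleMindedList b₀ (fun n => p (n / R) * b k₀) (i * R + R)) := fun i hi => by
    refine isInstance_singleMindedList (b₀ := b₀) hpb.le hb hb' (p := fun n => p (n / R))
      fun n hn => hple _ ?_
    have : n / R < i + 1 := by
      rw [Nat.div_lt_iff_lt_mul hRpos]
      linarith [add_one_mul i R]
    omega
  refine hf.not_staircase hp hα hφT hc hmono h0 hd hMpos (e := γ / 2) (by linarith) ?_
    (p := p) (ψ := fun i => ∑ n ∈ Finset.range (i * R + R), D n) (fun _ _ => rfl) ?_ ?_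
  · rw [← hγ, div_mul_eq_mul_div, div_le_iff₀ hM0]
    linarith
  · intro i hi
    exact ⟨Finset.sum_nonneg fun n _ => amountSold_nonneg _ hb.le _ n,
      (sum_amountSold_le_usage (A m) (S.nonneg m) _ _).trans ((A m).feasible _ (hinst i hi) k₀)⟩
  · intro i hi
    have hon := onlineWelfare_singleMinded_le (A m) (b₀ := b₀) (k₀ := k₀) hf (S.nonneg m)
      (p := fun n => p (n / R)) (hinst i hi)
    have hoff := profit_sub_le_offlineOpt (b₀ := b₀) (k₀ := k₀) hf (S.empty_mem m) hb hb'
      (v := fun n => p (n / R) * b k₀) (hp0 i hi) (s := i * R) (t := R) hR1 fun n hn hn' => by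
        have : n / R = i := Nat.div_eq_of_lt_le hn (by rwa [add_one_mul])
        rw [this]
    have hcomp := hm _ (hinst i hi)
    rw [sum_blocks_eq p _ hRpos i] at hon
    have hr := hsmall b hbB k₀
    have h2 : p i * b k₀ ≤ γ / 4 := by
      calc p i * b k₀ ≤ S.pbar * (γ / (4 * S.pbar)) :=
            mul_le_mul (hple i hi) hr hb.le hpb.le
        _ = γ / 4 := by field_simp
    have h3 : 1 / α * (profit S.f (p i) - p i * b k₀) ≤
        1 / α * offlineOpt S.f (singleMindedList b₀ (fun n => p (n / R) * b k₀) (i * R + R)) :=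
      mul_le_mul_of_nonneg_left hoff (by positivity)
    have h4 : 1 / α * (p i * b k₀) ≤ p i * b k₀ :=
      mul_le_of_le_one_left (mul_nonneg (hp0 i hi) hb.le) ((div_le_one hα).2 h1)
    have h5 : 1 / α * profit S.f (p i) = profit S.f (p i) / α := by ring
    rw [mul_sub, h5] at h3
    linarith

end OnlineCA

/-! ### The optimal competitive ratio -/

theorem OnlineCA.Setup.alphaStar_le {K : Type*} [Fintype K] {S : OnlineCA.Setup K} {α : ℝ}
    (h : S.Achievable α) : S.alphaStar ≤ (α : EReal) :=
  sInf_le ⟨α, rfl, h.1, h.bvpSolvable⟩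

theorem proposition1 {K : Type*} [Fintype K] (S : OnlineCA.Setup K) :
    (∀ a : ℝ, S.alphaStar = (a : EReal) → IsLeast {α : ℝ | S.Achievable α} a) ∧
    (S.alphaStar = ⊤ → ∀ α : ℝ, ¬ S.Achievable α) ∧
    (∀ ε : ℝ, 0 < ε → ∀ α : ℝ, (α : EReal) ≤ S.alphaStar - (ε : EReal) → ¬ S.Achievable α) := by
  refine ⟨fun a ha => ⟨?_, fun α hα => ?_⟩, fun htop α hα => ?_, fun ε hε α hle hα => ?_⟩
  -- The infimum need not be known to be attained: solvable ratios arbitrarily close above it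
  -- suffice.
  · refine S.achievable_of_bvpSolvable ?_ fun b hab => ?_
    · have h1 : ((1 : ℝ) : EReal) ≤ S.alphaStar := by
        refine le_sInf ?_
        rintro _ ⟨α, rfl, hα, -⟩
        exact EReal.coe_le_coe_iff.2 hα
      rw [ha] at h1
      exact EReal.coe_le_coe_iff.1 h1
    · have h1 : S.alphaStar < (b : EReal) := ha ▸ EReal.coe_lt_coe_iff.2 hab
      obtain ⟨_, ⟨α, rfl, hα1, hα⟩, hαb⟩ := sInf_lt_iff.1 h1
      refine ⟨α, EReal.coe_lt_coe_iff.1 hαb, ?_, hα⟩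
      have h2 : S.alphaStar ≤ (α : EReal) := sInf_le ⟨α, rfl, hα1, hα⟩
      rw [ha] at h2
      exact EReal.coe_le_coe_iff.1 h2
  · have h1 := OnlineCA.Setup.alphaStar_le hα
    rw [ha] at h1
    exact EReal.coe_le_coe_iff.1 h1
  · have h1 := OnlineCA.Setup.alphaStar_le hα
    rw [htop] at h1
    exact EReal.coe_ne_top α (top_le_iff.1 h1)
  · have h1 := EReal.sub_le_sub (OnlineCA.Setup.alphaStar_le hα) (le_refl (ε : EReal))
    have h2 := hle.trans h1
    rw [← EReal.coe_sub, EReal.coe_le_coe_iff] at h2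
    linarith
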